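/- Notation. $B(x,r)$ is the closed Euclidean ball in $\mathbb R^D$. The reach of $S\subset\mathbb R^D$ is the supremum in $[0,\infty]$ of all $r\ge 0$ such that every $y\in\bigcup_{x\in S}B(x,r)$ has a unique nearest point in $S$. For a probability measure $\mathbb P$ on $\mathbb R^D$, points $M_1,M_2\in\mathbb R^D$ and $r>0$, the gap coefficient is \[ q_{\mathbb P}=\frac{\mathbb P\big(B(M_1,r)\cap B(M_2,r)\big)}{\mathbb P\big(B(M_1,r)\cup B(M_2,r)\big)} . \] With $B(x,a,b)=\int_0^x t^{a-1}(1-t)^{b-1}\,dt$ and $B(a,b)=B(1,a,b)$, the volume coefficient in dimension $d$ is \[ q_d(s)=\left(2\,\frac{B\left(\frac{d+1}{2},\frac12\right)}{B\left(1-\frac{s^2}{4},\frac{d+1}{2},\frac12\right)}-1\right)^{-1}. \] Lemma. Let $r>0$ and let $\mathbb P$ be the distribution of a random variable $X+\xi$, where $X$ is uniformly distributed on a compact $d$-dimensional $C^2$ submanifold $\mathcal M$ of $\mathbb R^D$ without boundary (that is, with respect to its $d$-dimensional volume), and $\|\xi\|\le r_\xi$ almost surely. Suppose that $\operatorname{reach}(\mathcal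 M)\ge\frac1\kappa$ with $\kappa>0$, that \[ r_\xi\le\frac{r}{\max\{20,5d\}},\qquad r\le\frac{1}{\max\{48,6d\}\,\kappa}, \] and that, for some $b'<2$, \[ 1<b\le\frac{b'}{(1+3\kappa r)\left(1+5\frac{r_\xi}{r}\right)} . \] Let $M_1,M_2$ be two points in the support of $\mathbb P$ with $\|M_1-M_2\|\le br$, and put $s=\frac{\|M_1-M_2\|}{r}$. Then \[ (1+\varepsilon_{\mathcal M})^{-1}(1+\varepsilon_\xi)^{-1}\le\frac{q_{\mathbb P}}{q_d(s)}\le(1+\varepsilon_{\mathcal M})(1+\varepsilon_\xi), \] where \[ \varepsilon_{\mathcal M}=\frac{84\,\kappa\,(d+1)\,r}{\left(1-\left(\frac{b'}{2}\right)^2\right)^{\frac{d+1}{2}}},\qquad \varepsilon_\xi=\frac{80\,(d+1)\,\frac{r_\xi}{r}}{\left(1-\left(\frac{b'}{2}\right)^2\right)^{\frac{d+1}{2}}} . \] -/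

import Mathlib

open MeasureTheory Set
open scoped ENNReal MeasureTheory

noncomputable section

/-- The reach of a set `S`: the supremum (possibly `∞`) of the radii `r ≥ 0` such that every point
of the offset `⋃ x ∈ S, B(x, r)` has exactly one nearest point in `S`. -/
def reach {D : ℕ} (S : Set (EuclideanSpace ℝ (Fin D))) : ℝ≥0∞ :=
  sSup (ENNReal.ofReal '' {r : ℝ | 0 ≤ r ∧
    ∀ y ∈ ⋃ x ∈ S, Metric.closedBall x r, ∃! x, x ∈ S ∧ ∀ z ∈ S, dist y x ≤ dist y z})

/-- `M` is a `d`-dimensional (embedded) `C²` submanifold of `ℝ^D` without boundary: around each of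
its points there is a `C²` diffeomorphism `φ` between open subsets `U`, `V` of `ℝ^D` which maps
`M ∩ U` onto `W ∩ V` for a `d`-dimensional linear subspace `W`. -/
def IsC2Submanifold {D : ℕ} (d : ℕ) (M : Set (EuclideanSpace ℝ (Fin D))) : Prop :=
  ∀ p ∈ M, ∃ (φ : OpenPartialHomeomorph (EuclideanSpace ℝ (Fin D)) (EuclideanSpace ℝ (Fin D)))
    (W : Submodule ℝ (EuclideanSpace ℝ (Fin D))),
    Module.finrank ℝ W = d ∧ p ∈ φ.source ∧
    ContDiffOn ℝ 2 φ φ.source ∧ ContDiffOn ℝ 2 φ.symm φ.target ∧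
    φ.IsImage M (W : Set (EuclideanSpace ℝ (Fin D)))

/-- The incomplete beta function `B(x, a, b)`; the beta function is `B(1, a, b)`. -/
def incompleteBeta (x a b : ℝ) : ℝ :=
  ∫ t in (0 : ℝ)..x, t ^ (a - 1) * (1 - t) ^ (b - 1)

/-- The volume coefficient `q_d(s)` in dimension `d`. -/
def volumeCoef (d : ℕ) (s : ℝ) : ℝ :=
  (2 * (incompleteBeta 1 (((d : ℝ) + 1) / 2) (1 / 2) /
    incompleteBeta (1 - s ^ 2 / 4) (((d : ℝ) + 1) / 2) (1 / 2)) - 1)⁻¹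

/-- The gap coefficient of the measure `P` for the points `M₁`, `M₂` and the bandwidth `r`. -/
def gapCoef {D : ℕ} (P : Measure (EuclideanSpace ℝ (Fin D))) (M₁ M₂ : EuclideanSpace ℝ (Fin D))
    (r : ℝ) : ℝ :=
  P.real (Metric.closedBall M₁ r ∩ Metric.closedBall M₂ r) /
    P.real (Metric.closedBall M₁ r ∪ Metric.closedBall M₂ r)

/-- The assumptions `A(r₀, r₁)` on the distribution `P` and the tuning parameters `r`, `b`, `b'`.
The noise `ξ` need not be independent of `X`. The uniform distribution on the manifold `M` is the
normalized restriction to `M` of the `d`-dimensional Hausdorff measure. -/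
structure AssumptionsA {Ω : Type*} [MeasurableSpace Ω] {D : ℕ} (ℙ : Measure Ω)
    (X ξ : Ω → EuclideanSpace ℝ (Fin D)) (P : Measure (EuclideanSpace ℝ (Fin D)))
    (M : Set (EuclideanSpace ℝ (Fin D))) (d : ℕ) (κ rξ r b b' r₀ r₁ : ℝ) : Prop where
  aemeasurable_X : AEMeasurable X ℙ
  aemeasurable_noise : AEMeasurable ξ ℙ
  law : P = ℙ.map (fun ω => X ω + ξ ω)
  uniform : pdf.IsUniform X M ℙ (Measure.hausdorffMeasure (d : ℝ))
  noise_le : ∀ᵐ ω ∂ℙ, ‖ξ ω‖ ≤ rξ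
  compact : IsCompact M
  submanifold : IsC2Submanifold d M
  κ_pos : 0 < κ
  le_reach : ENNReal.ofReal (1 / κ) ≤ reach M
  rξ_le : rξ ≤ r₀ / max 20 (5 * (d : ℝ))
  r₁_le : r₁ ≤ 1 / (max 48 (6 * (d : ℝ)) * κ)
  one_lt_b : 1 < b
  b_le : b ≤ b' / ((1 + 3 * κ * r) * (1 + 5 * (rξ / r)))
  b'_lt : b' < 2

/-- The error term `ε_M`, due to the curvature of the manifold. -/
def epsManifold (d : ℕ) (κ r b' : ℝ) : ℝ :=
  84 * κ * ((d : ℝ) + 1) * r / (1 - (b' / 2) ^ 2) ^ (((d : ℝ) + 1) / 2)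

/-- The error term `ε_ξ`, due to the noise. -/
def epsNoise (d : ℕ) (rξ r b' : ℝ) : ℝ :=
  80 * ((d : ℝ) + 1) * (rξ / r) / (1 - (b' / 2) ^ 2) ^ (((d : ℝ) + 1) / 2)

end

/-!
# The gap coefficient of a noisy sample from a submanifold

Write `k = κ r` for the curvature of `M` on the scale `r` and `e = rξ / r` for the relative noise.

*Geometry.* Let `δ` be the distance to `M`. Where foot points are unique they depend continuously on
the point, so `δ` grows at unit rate in the direction away from the foot point. By Ekeland's
principle `δ` then reaches `δ y + ε` on the ball of radius `ε` around `y`, which forces foot points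
to persist along normal rays up to the reach (`UniqueFoot.isFoot_ray`). Hence `M` deviates
from its tangent space at `p` by at most `κ / 2` times the squared distance to `p`
(`TangentField.norm_perp_le`), and the foot point is a Lipschitz function near `M`
(`UniqueFoot.foot_lipschitz`). Three nearby points of `M` give a local Lipschitz bound for the
tangent spaces. It is integrated along the projection to `M` of a segment between two points of `M`
(`TangentField.norm_tangent_normal_le`), which makes the projection of `M` to a tangent space
bi-Lipschitz with constant `1 + 4 k` near the point of tangency. It also covers a ball of the
tangent space (`TangentField.exists_proj_eq`).

*Volumes.* Up to the factor `(1 + 4 k) ^ d` and changes of the radius of relative size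
`2 e + k`, the intersection and the union of two balls therefore have the same volume in `M` as in
Euclidean space (`TangentField.exists_lens_bounds`). By Fubini's theorem a Euclidean lens with
radius `ρ` and half distance `a ρ` of the centers has a volume proportional to
`ρ ^ d * lensProfile d a`, where `lensProfile d a = ∫ u in a..1, (1 - u ^ 2) ^ ((d - 1) / 2)`
(`hausdorffMeasure_lens`); a substitution turns this into an incomplete beta function, so that
`volumeCoef d s` is the ratio of intersection and union for unperturbed parameters.

*Sensitivity.* The profile is `1`-Lipschitz and bounded below by
`(1 - a ^ 2) ^ ((d + 1) / 2) / (d + 1)`, which gives the error terms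
(`lensProfile_le_mul`, `error_factor_le`). Only the volume of the intersection contributes the
denominator of the error terms; the union contains a ball. In dimension zero the points of `M` are
isolated and the gap coefficient is `1`.
-/

open Metric Filter Topology

/-! ### Foot points and normals of sets of positive reach -/

/-- `p` is a foot point of `y` on `M`: a point of `M` nearest to `y`. -/
def IsFoot {E : Type*} [PseudoMetricSpace E] (M : Set E) (y p : E) : Prop :=
  p ∈ M ∧ dist y p = infDist y M

/-- Points at distance less than `R` from `M` have at most one foot point on `M`. For a nonempty
compact set `M` this says that the reach of `M` is at least `R`. -/
def UniqueFoot {E : Type*} [PseudoMetricSpace E] (M : Set E) (R : ℝ) : Prop :=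
  ∀ y, infDist y M < R → ∀ p q, IsFoot M y p → IsFoot M y q → p = q

theorem isFoot_iff {E : Type*} [PseudoMetricSpace E] {M : Set E} {y p : E} :
    IsFoot M y p ↔ p ∈ M ∧ ∀ z ∈ M, dist y p ≤ dist y z := by
  refine and_congr_right fun hp => ⟨fun h z hz => h ▸ infDist_le_dist_of_mem hz, fun h => ?_⟩
  exact le_antisymm ((le_infDist ⟨p, hp⟩).2 fun z hz => h z hz) (infDist_le_dist_of_mem hp)

theorem uniqueFoot_of_le_reach {D : ℕ} {M : Set (EuclideanSpace ℝ (Fin D))} (hne : M.Nonempty)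
    {R : ℝ} (hR : ENNReal.ofReal R ≤ reach M) : UniqueFoot M R := by
  intro y hy p q hp hq
  have hlt : ENNReal.ofReal (infDist y M) < reach M := by
    refine lt_of_lt_of_le ?_ hR
    exact (ENNReal.ofReal_lt_ofReal_iff (infDist_nonneg.trans_lt hy)).2 hy
  obtain ⟨_, ⟨t, ⟨ht0, ht⟩, rfl⟩, hlt'⟩ := lt_sSup_iff.1 hlt
  have h1 : infDist y M < t := by
    by_contra h
    exact absurd (ENNReal.ofReal_le_ofReal (not_lt.1 h)) (not_le.2 hlt')
  obtain ⟨x, hx, hxy⟩ := (infDist_lt_iff hne).1 h1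
  exact (ht y (mem_iUnion₂.2 ⟨x, hx, mem_closedBall.2 hxy.le⟩)).unique
    (isFoot_iff.1 hp) (isFoot_iff.1 hq)

section Foot

variable {E : Type*} [PseudoMetricSpace E] {M : Set E}

theorem IsCompact.exists_isFoot (hM : IsCompact M) (hne : M.Nonempty) (y : E) :
    ∃ p, IsFoot M y p := by
  obtain ⟨p, hp, h⟩ := hM.exists_infDist_eq_dist hne y
  exact ⟨p, hp, h.symm⟩

theorem IsFoot.of_mem {p : E} (hp : p ∈ M) : IsFoot M p p :=
  ⟨hp, by rw [dist_self, infDist_zero_of_mem hp]⟩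

/-- Foot points depend continuously on the point wherever they are unique. -/
theorem UniqueFoot.tendsto {R : ℝ} (hU : UniqueFoot M R) (hM : IsCompact M)
    {ι : Type*} {l : Filter ι} {f g : ι → E} {y p : E} (hy : infDist y M < R)
    (hp : IsFoot M y p) (hf : Tendsto f l (𝓝 y)) (hg : ∀ i, IsFoot M (f i) (g i)) :
    Tendsto g l (𝓝 p) := by
  refine hM.tendsto_nhds_of_unique_mapClusterPt (Eventually.of_forall fun i => (hg i).1) ?_
  intro x hx hcl
  refine hU y hy _ _ ⟨hx, ?_⟩ hp
  have h1 : MapClusterPt (y, x) l (fun i => (f i, g i)) := by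
    have := hcl
    rw [mapClusterPt_iff_frequently] at this ⊢
    intro s hs
    rw [nhds_prod_eq] at hs
    obtain ⟨u, hu, v, hv, huv⟩ := Filter.mem_prod_iff.1 hs
    refine ((this v hv).and_eventually (hf hu)).mono fun i hi => huv ⟨hi.2, hi.1⟩
  have h2 : IsClosed {z : E × E | dist z.1 z.2 = infDist z.1 M} :=
    isClosed_eq continuous_dist ((continuous_infDist_pt M).comp continuous_fst)
  have h3 : ∀ᶠ z in map (fun i => (f i, g i)) l, z ∈ {z : E × E | dist z.1 z.2 = infDist z.1 M} :=
    Eventually.of_forall (fun i => (hg i).2) |> Filter.eventually_map.2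
  exact isClosed_iff_clusterPt.1 h2 _ (ClusterPt.mono h1 (le_principal_iff.2 h3))

end Foot

section Normal

variable {E : Type*} [NormedAddCommGroup E] [InnerProductSpace ℝ E]
  {M : Set E} {R : ℝ}

local notation "⟪" x ", " y "⟫" => inner ℝ x y

/-- Moving away from the foot point increases the distance to `M` at almost unit rate. -/
theorem UniqueFoot.eventually_climb (hU : UniqueFoot M R) (hM : IsCompact M) {y p : E}
    (hy : infDist y M < R) (hp : IsFoot M y p) (h0 : 0 < infDist y M) {c : ℝ} (hc0 : 0 ≤ c)
    (hc : c < 1) :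
    ∀ᶠ h : ℝ in 𝓝[>] 0,
      infDist y M + c * h ≤ infDist (y + (h / infDist y M) • (y - p)) M := by
  set δ := infDist y M with hδ
  have hne : M.Nonempty := ⟨p, hp.1⟩
  have hnorm : ‖y - p‖ = δ := by rw [← dist_eq_norm]; exact hp.2
  choose g hg using fun h : ℝ => hM.exists_isFoot hne (y + (h / δ) • (y - p))
  have ht : Tendsto (fun h : ℝ => y + (h / δ) • (y - p)) (𝓝[>] 0) (𝓝 y) := by
    have : Continuous fun h : ℝ => y + (h / δ) • (y - p) := by fun_prop
    have h2 := this.tendsto 0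
    simp only [zero_div, zero_smul, add_zero] at h2
    exact h2.mono_left nhdsWithin_le_nhds
  have hgt := hU.tendsto hM hy hp ht hg
  have hin : Tendsto (fun h => ⟪y - p, y - g h⟫) (𝓝[>] 0) (𝓝 ⟪y - p, y - p⟫) :=
    tendsto_const_nhds.inner (tendsto_const_nhds.sub hgt)
  rw [real_inner_self_eq_norm_sq, hnorm] at hin
  have hlt : (1 + c) / 2 * δ ^ 2 < δ ^ 2 := by nlinarith [sq_pos_of_pos h0]
  filter_upwards [hin.eventually_const_lt hlt, self_mem_nhdsWithin] with h h1 h3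
  have h3 : 0 < h := h3
  rw [← (hg h).2, dist_eq_norm]
  refine le_of_sq_le_sq ?_ (norm_nonneg _)
  have e1 : y + (h / δ) • (y - p) - g h = (y - g h) + (h / δ) • (y - p) := by abel
  rw [e1, norm_add_sq_real, inner_smul_right, norm_smul, hnorm, Real.norm_of_nonneg (by positivity),
    div_mul_cancel₀ _ h0.ne', real_inner_comm]
  have h4 : δ ≤ ‖y - g h‖ := by
    rw [← dist_eq_norm]; exact infDist_le_dist_of_mem (hg h).1
  have h5 : (1 + c) / 2 * δ * h ≤ h / δ * ⟪y - p, y - g h⟫ := by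
    have h6 := mul_le_mul_of_nonneg_left h1.le (div_pos h3 h0).le
    have h7 : h / δ * ((1 + c) / 2 * δ ^ 2) = (1 + c) / 2 * δ * h := by field_simp
    linarith
  have h6 : δ ^ 2 ≤ ‖y - g h‖ ^ 2 := pow_le_pow_left₀ h0.le h4 2
  have h7 : 0 ≤ (1 - c) * (δ * h) := mul_nonneg (by linarith) (by positivity)
  have h8 : 0 ≤ (1 - c) * (1 + c) * h ^ 2 :=
    mul_nonneg (mul_nonneg (by linarith) (by linarith)) (sq_nonneg h)
  nlinarith

variable [ProperSpace E]

/-- Around a point off `M`, the distance to `M` attains, on a ball inside the region of unique foot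
points, the largest value that its Lipschitz continuity allows. -/
theorem UniqueFoot.exists_infDist_ge (hU : UniqueFoot M R) (hM : IsCompact M) (hne : M.Nonempty)
    {y₀ : E} {ε : ℝ} (hε : 0 < ε) (h0 : 0 < infDist y₀ M) (hR : infDist y₀ M + ε < R) :
    ∃ y, dist y y₀ ≤ ε ∧ infDist y₀ M + ε ≤ infDist y M := by
  have hlip : ∀ y, infDist y M ≤ infDist y₀ M + dist y y₀ := fun y => infDist_le_infDist_add_dist
  obtain ⟨y, hy, hmax⟩ := (isCompact_closedBall y₀ ε).exists_isMaxOn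
    ⟨y₀, mem_closedBall_self hε.le⟩ (continuous_infDist_pt M).continuousOn
  refine ⟨y, hy, ?_⟩
  have key : ∀ c : ℝ, 0 ≤ c → c < 1 → infDist y₀ M + c * ε ≤ infDist y M := by
    intro c hc0 hc1
    set c' := (1 + c) / 2
    have hcc : c < c' := by simp only [c']; linarith
    have hc1' : c' < 1 := by simp only [c']; linarith
    -- Ekeland's principle: a maximizer of the distance penalized with slope `c < 1` cannot lie in
    -- the open ball.
    obtain ⟨z, hz, hzmax⟩ := (isCompact_closedBall y₀ ε).exists_isMaxOn
      (f := fun z => infDist z M - c * dist z y₀) ⟨y₀, mem_closedBall_self hε.le⟩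
      (by fun_prop)
    have hz0 : infDist y₀ M ≤ infDist z M - c * dist z y₀ := by
      have := hzmax (mem_closedBall_self hε.le)
      simpa using this
    rcases (mem_closedBall.1 hz).lt_or_eq with hlt | heq
    · exfalso
      obtain ⟨p, hp⟩ := hM.exists_isFoot hne z
      have hzpos : 0 < infDist z M := by
        have : 0 ≤ c * dist z y₀ := by positivity
        linarith
      have hzR : infDist z M < R := by linarith [hlip z]
      have hcl := hU.eventually_climb hM hzR hp hzpos (hc0.trans hcc.le) hc1'
      have hsm : ∀ᶠ h : ℝ in 𝓝[>] 0, h < ε - dist z y₀ := by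
        have : Tendsto (fun h : ℝ => h) (𝓝[>] 0) (𝓝 0) := nhdsWithin_le_nhds
        exact this.eventually_lt_const (by linarith)
      obtain ⟨h, ⟨h1, h2⟩, h3⟩ := ((hcl.and hsm).and self_mem_nhdsWithin).exists
      have h3 : 0 < h := h3
      have hd : dist (z + (h / infDist z M) • (z - p)) y₀ ≤ dist z y₀ + h := by
        refine (dist_triangle _ z _).trans ?_
        rw [dist_eq_norm, add_sub_cancel_left, norm_smul, Real.norm_of_nonneg (by positivity),
          ← dist_eq_norm, hp.2, div_mul_cancel₀ _ hzpos.ne', add_comm]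
      have := hzmax (mem_closedBall.2 (hd.trans (by linarith)))
      simp only [mem_ofPred_eq] at this
      nlinarith
    · rw [heq] at hz0
      have := hmax hz
      simp only [mem_ofPred_eq] at this
      linarith
  have ht : Tendsto (fun c : ℝ => infDist y₀ M + c * ε) (𝓝[<] 1) (𝓝 (infDist y₀ M + 1 * ε)) := by
    have : Continuous fun c : ℝ => infDist y₀ M + c * ε := by fun_prop
    exact (this.tendsto 1).mono_left nhdsWithin_le_nhds
  rw [one_mul] at ht
  refine le_of_tendsto ht ?_
  filter_upwards [Ioo_mem_nhdsLT (show (0 : ℝ) < 1 by norm_num)] with c hc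
  exact key c hc.1.le hc.2

/-- A point remains the foot point along its normal rays, up to the reach. -/
theorem UniqueFoot.isFoot_ray (hU : UniqueFoot M R) (hM : IsCompact M) {p v : E} (hv : ‖v‖ = 1)
    {t₀ t : ℝ} (ht₀ : 0 < t₀) (hfoot : IsFoot M (p + t₀ • v) p) (htt : t₀ < t) (htR : t < R) :
    IsFoot M (p + t • v) p := by
  have hd0 : infDist (p + t₀ • v) M = t₀ := by
    rw [← hfoot.2, dist_eq_norm, add_sub_cancel_left, norm_smul, hv, mul_one,
      Real.norm_of_nonneg ht₀.le]
  obtain ⟨y, hy1, hy2⟩ := hU.exists_infDist_ge hM ⟨p, hfoot.1⟩ (ε := t - t₀) (sub_pos.2 htt)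
    (by rw [hd0]; exact ht₀) (by rw [hd0]; linarith)
  rw [hd0] at hy2
  have hyp : infDist y M ≤ dist y p := infDist_le_dist_of_mem hfoot.1
  set w := y - (p + t₀ • v) with hw
  have hwn : ‖w‖ ≤ t - t₀ := by rw [hw, ← dist_eq_norm]; exact hy1
  have e1 : y - p = w + t₀ • v := by rw [hw]; abel
  have hn : t ≤ ‖w + t₀ • v‖ := by rw [← e1, ← dist_eq_norm]; linarith
  -- equality in the triangle inequality forces `w` to be a multiple of `v`
  have hin : (t - t₀) ≤ ⟪w, v⟫ := by
    have h1 : t ^ 2 ≤ ‖w + t₀ • v‖ ^ 2 := pow_le_pow_left₀ (by linarith) hn 2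
    rw [norm_add_sq_real, inner_smul_right, norm_smul, hv, Real.norm_of_nonneg ht₀.le] at h1
    have h2 : ‖w‖ ^ 2 ≤ (t - t₀) ^ 2 := pow_le_pow_left₀ (norm_nonneg _) hwn 2
    have h3 : t₀ * (t - t₀) ≤ t₀ * ⟪w, v⟫ := by nlinarith
    exact le_of_mul_le_mul_left h3 ht₀
  have hwv : w = (t - t₀) • v := by
    have h1 : ‖w - (t - t₀) • v‖ ^ 2 ≤ 0 := by
      rw [norm_sub_sq_real, inner_smul_right, norm_smul, hv, Real.norm_of_nonneg (by linarith)]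
      have h2 : ‖w‖ ^ 2 ≤ (t - t₀) ^ 2 := pow_le_pow_left₀ (norm_nonneg _) hwn 2
      nlinarith
    have h2 : ‖w - (t - t₀) • v‖ = 0 := by
      have := norm_nonneg (w - (t - t₀) • v)
      nlinarith
    exact sub_eq_zero.1 (norm_eq_zero.1 h2)
  have hyt : y = p + t • v := by
    rw [← sub_eq_iff_eq_add', e1, hwv, ← add_smul, sub_add_cancel]
  rw [← hyt]
  refine ⟨hfoot.1, le_antisymm ?_ hyp⟩
  have : dist y p = t := by
    rw [hyt, dist_eq_norm, add_sub_cancel_left, norm_smul, hv, mul_one,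
      Real.norm_of_nonneg (by linarith)]
  linarith

/-- Balls of radius less than the reach that touch `M` from a normal direction do not meet `M`. -/
theorem UniqueFoot.inner_le (hU : UniqueFoot M R) (hM : IsCompact M) {p v : E} (hv : ‖v‖ = 1)
    {t₀ : ℝ} (ht₀ : 0 < t₀) (ht₀R : t₀ < R) (hfoot : IsFoot M (p + t₀ • v) p) {y : E}
    (hy : y ∈ M) : 2 * R * ⟪v, y - p⟫ ≤ ‖y - p‖ ^ 2 := by
  have key : ∀ t, t₀ < t → t < R → 2 * t * ⟪v, y - p⟫ ≤ ‖y - p‖ ^ 2 := by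
    intro t h1 h2
    have h3 := (isFoot_iff.1 (hU.isFoot_ray hM hv ht₀ hfoot h1 h2)).2 y hy
    have h4 : dist (p + t • v) p ^ 2 ≤ dist (p + t • v) y ^ 2 := pow_le_pow_left₀ dist_nonneg h3 2
    have e1 : p + t • v - y = t • v - (y - p) := by abel
    rw [dist_eq_norm, dist_eq_norm, add_sub_cancel_left, e1, norm_sub_sq_real, inner_smul_left] at h4
    simp only [conj_trivial] at h4
    linarith
  have ht : Tendsto (fun t : ℝ => 2 * t * ⟪v, y - p⟫) (𝓝[<] R) (𝓝 (2 * R * ⟪v, y - p⟫)) := by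
    have : Continuous fun t : ℝ => 2 * t * ⟪v, y - p⟫ := by fun_prop
    exact (this.tendsto R).mono_left nhdsWithin_le_nhds
  refine le_of_tendsto ht ?_
  filter_upwards [Ioo_mem_nhdsLT ht₀R] with t ht
  exact key t ht.1 ht.2

theorem UniqueFoot.inner_foot_le (hU : UniqueFoot M R) (hM : IsCompact M) {a p q : E}
    (ha : infDist a M < R) (hp : IsFoot M a p) (hq : q ∈ M) :
    2 * R * ⟪a - p, q - p⟫ ≤ infDist a M * ‖q - p‖ ^ 2 := by
  have hn : ‖a - p‖ = infDist a M := by rw [← dist_eq_norm]; exact hp.2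
  rcases (infDist_nonneg (x := a) (s := M)).eq_or_lt with h0 | h0
  · rw [← h0, norm_eq_zero] at hn
    simp [hn, ← h0]
  · have := hU.inner_le hM (v := (infDist a M)⁻¹ • (a - p)) (p := p) (t₀ := infDist a M) (by
      rw [norm_smul, hn, norm_inv, Real.norm_of_nonneg h0.le, inv_mul_cancel₀ h0.ne']) h0 ha
      (by rw [smul_smul, mul_inv_cancel₀ h0.ne', one_smul, add_sub_cancel]; exact hp) hq
    rw [inner_smul_left] at this
    simp only [conj_trivial] at this
    have h2 := mul_le_mul_of_nonneg_left this h0.le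
    have e : infDist a M * (2 * R * ((infDist a M)⁻¹ * ⟪a - p, q - p⟫)) = 2 * R * ⟪a - p, q - p⟫ := by
      field_simp
    linarith

/-- Federer: within distance `τ < R` of `M` the foot point is a Lipschitz function with constant
`(1 - τ / R)⁻¹`. -/
theorem UniqueFoot.foot_lipschitz (hU : UniqueFoot M R) (hM : IsCompact M) {a b p q : E} {τ : ℝ}
    (hτ : τ < R) (ha : infDist a M ≤ τ) (hb : infDist b M ≤ τ) (hp : IsFoot M a p)
    (hq : IsFoot M b q) : (1 - τ / R) * ‖p - q‖ ≤ ‖a - b‖ := by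
  have hR : 0 < R := (infDist_nonneg.trans ha).trans_lt hτ
  have h1 := hU.inner_foot_le hM (ha.trans_lt hτ) hp hq.1
  have h2 := hU.inner_foot_le hM (hb.trans_lt hτ) hq hp.1
  rw [norm_sub_rev q p] at h1
  have h3 : ⟪a - p, q - p⟫ + ⟪b - q, p - q⟫ = ‖p - q‖ ^ 2 - ⟪a - b, p - q⟫ := by
    rw [← real_inner_self_eq_norm_sq, ← inner_sub_left, ← neg_sub p q, inner_neg_right,
      ← sub_eq_neg_add, ← inner_sub_left]
    congr 1; abel
  have h4 := real_inner_le_norm (a - b) (p - q)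
  rcases (norm_nonneg (p - q)).eq_or_lt with h0 | h0
  · rw [← h0]; simp
  · refine le_of_mul_le_mul_right ?_ h0
    have h5 : 2 * R * ‖p - q‖ ^ 2 - 2 * R * ⟪a - b, p - q⟫ ≤ 2 * τ * ‖p - q‖ ^ 2 := by
      have h6 := mul_le_mul_of_nonneg_right ha (sq_nonneg ‖p - q‖)
      have h7 := mul_le_mul_of_nonneg_right hb (sq_nonneg ‖p - q‖)
      have h8 : 2 * R * ⟪a - p, q - p⟫ + 2 * R * ⟪b - q, p - q⟫
        = 2 * R * ‖p - q‖ ^ 2 - 2 * R * ⟪a - b, p - q⟫ := by rw [← mul_add, h3]; ring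
      linarith
    have h9 : R * ((1 - τ / R) * ‖p - q‖ * ‖p - q‖) ≤ R * (‖a - b‖ * ‖p - q‖) := by
      have : R * ((1 - τ / R) * ‖p - q‖ * ‖p - q‖) = (R - τ) * ‖p - q‖ ^ 2 := by field_simp
      rw [this]; nlinarith
    exact le_of_mul_le_mul_left h9 hR

end Normal

/-! ### Tangent spaces of submanifolds -/

section Chart

variable {E : Type*} [NormedAddCommGroup E] [InnerProductSpace ℝ E]
  {φ : OpenPartialHomeomorph E E}

theorem chart_symm_deriv_comp (h1 : ContDiffOn ℝ 2 φ φ.source)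
    (h2 : ContDiffOn ℝ 2 φ.symm φ.target) {q : E} (hq : q ∈ φ.source) (u : E) :
    fderiv ℝ φ.symm (φ q) (fderiv ℝ φ q u) = u := by
  have d1 : HasFDerivAt φ (fderiv ℝ φ q) q :=
    ((h1.contDiffAt (φ.open_source.mem_nhds hq)).differentiableAt (by norm_num)).hasFDerivAt
  have d2 : HasFDerivAt φ.symm (fderiv ℝ φ.symm (φ q)) (φ q) :=
    ((h2.contDiffAt (φ.open_target.mem_nhds (φ.map_source hq))).differentiableAt
      (by norm_num)).hasFDerivAt
  have d3 := d2.comp q d1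
  have d4 : HasFDerivAt (φ.symm ∘ φ) (ContinuousLinearMap.id ℝ E) q := by
    refine (hasFDerivAt_id q).congr_of_eventuallyEq ?_
    filter_upwards [φ.open_source.mem_nhds hq] with x hx
    exact φ.left_inv hx
  exact congrArg (fun L : E →L[ℝ] E => L u) (d3.unique d4)

theorem chart_deriv_symm_comp (h1 : ContDiffOn ℝ 2 φ φ.source)
    (h2 : ContDiffOn ℝ 2 φ.symm φ.target) {q : E} (hq : q ∈ φ.source) (u : E) :
    fderiv ℝ φ q (fderiv ℝ φ.symm (φ q) u) = u := by
  have := chart_symm_deriv_comp (φ := φ.symm) h2 h1 (φ.map_source hq) u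
  rwa [φ.left_inv hq, φ.symm_symm] at this

/-- The tangent space at `q` of the set that the chart `φ` straightens to `W`. -/
noncomputable def chartTangent (φ : OpenPartialHomeomorph E E) (W : Submodule ℝ E) (q : E) : Submodule ℝ E :=
  W.comap (fderiv ℝ φ q : E →ₗ[ℝ] E)

theorem finrank_chartTangent (h1 : ContDiffOn ℝ 2 φ φ.source)
    (h2 : ContDiffOn ℝ 2 φ.symm φ.target) (W : Submodule ℝ E) {q : E} (hq : q ∈ φ.source) :
    Module.finrank ℝ (chartTangent φ W q) = Module.finrank ℝ W := by
  let e : E ≃ₗ[ℝ] E :=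
    { (fderiv ℝ φ q : E →ₗ[ℝ] E) with
      invFun := fderiv ℝ φ.symm (φ q)
      left_inv := chart_symm_deriv_comp h1 h2 hq
      right_inv := chart_deriv_symm_comp h1 h2 hq }
  have : chartTangent φ W q = W.map (e.symm : E →ₗ[ℝ] E) := by
    rw [← Submodule.comap_equiv_eq_map_symm]; rfl
  rw [this]
  exact LinearEquiv.finrank_map_eq e.symm W

/-- Small tangent vectors of the set straightened by a chart are approximated by secants, uniformly
near each point. -/
theorem chart_fill (h1 : ContDiffOn ℝ 2 φ φ.source)
    (h2 : ContDiffOn ℝ 2 φ.symm φ.target) {M : Set E} {W : Submodule ℝ E}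
    (hM : φ.IsImage M (W : Set E)) {p : E} (hp : p ∈ φ.source) {ε : ℝ} (hε : 0 < ε) :
    ∃ ρ : ℝ, 0 < ρ ∧ ∀ q ∈ M, dist q p < ρ → q ∈ φ.source ∧
      ∀ u ∈ chartTangent φ W q, ‖u‖ < ρ → ∃ p' ∈ M, ‖p' - q - u‖ ≤ ε * ‖u‖ := by
  have hc : ContDiffAt ℝ 2 φ p := h1.contDiffAt (φ.open_source.mem_nhds hp)
  have hc' : ContDiffAt ℝ 2 φ.symm (φ p) :=
    h2.contDiffAt (φ.open_target.mem_nhds (φ.map_source hp))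
  set A := fderiv ℝ φ p
  set B := fderiv ℝ φ.symm (φ p)
  set c := ε / (2 * (‖A‖ + 1)) with hcdef
  have hcpos : 0 < c := by positivity
  have hstrict : HasStrictFDerivAt φ.symm B (φ p) :=
    hc'.hasStrictFDerivAt (by norm_num)
  have hlin := (hasStrictFDerivAt_iff_isLittleO.1 hstrict).def hcpos
  rw [nhds_prod_eq, Filter.Eventually, Filter.mem_prod_same_iff] at hlin
  obtain ⟨V, hV, hVlin⟩ := hlin
  have hcont : ContinuousAt (fderiv ℝ φ) p :=
    (hc.fderiv_right (m := 1) (by norm_num)).continuousAt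
  have hcontB : ContinuousAt (fun q => fderiv ℝ φ.symm (φ q)) p :=
    ContinuousAt.comp (g := fderiv ℝ φ.symm) (f := φ)
      (hc'.fderiv_right (m := 1) (by norm_num)).continuousAt hc.continuousAt
  obtain ⟨r, hr, hball⟩ := Metric.mem_nhds_iff.1
    (inter_mem hV (φ.open_target.mem_nhds (φ.map_source hp)))
  have hev : ∀ᶠ q in 𝓝 p, q ∈ φ.source ∧ ‖fderiv ℝ φ q - A‖ < 1 ∧
      ‖fderiv ℝ φ.symm (φ q) - B‖ < c ∧ dist (φ q) (φ p) < r / 2 := by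
    refine Filter.Eventually.and (φ.open_source.mem_nhds hp) (Filter.Eventually.and ?_
      (Filter.Eventually.and ?_ ?_))
    · simpa [dist_eq_norm] using Metric.tendsto_nhds.1 hcont 1 one_pos
    · simpa [dist_eq_norm] using Metric.tendsto_nhds.1 hcontB c hcpos
    · exact Metric.tendsto_nhds.1 hc.continuousAt (r / 2) (by positivity)
  obtain ⟨ρ, hρ, hρball⟩ := Metric.eventually_nhds_iff.1 hev
  refine ⟨min ρ (r / (2 * (‖A‖ + 1))), by positivity, fun q hq hqp => ?_⟩
  obtain ⟨hqs, hA, hB, hφ⟩ := hρball (hqp.trans_le (min_le_left _ _))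
  refine ⟨hqs, fun u hu hun => ?_⟩
  set w := fderiv ℝ φ q u with hw
  have hwW : w ∈ W := hu
  have hwn : ‖w‖ ≤ (‖A‖ + 1) * ‖u‖ := by
    refine (ContinuousLinearMap.le_opNorm _ _).trans ?_
    gcongr
    have := norm_add_le (fderiv ℝ φ q - A) A
    rw [sub_add_cancel] at this
    linarith
  have hwr : ‖w‖ < r / 2 := by
    refine hwn.trans_lt ?_
    have := hun.trans_le (min_le_right _ _)
    rw [lt_div_iff₀ (by positivity)] at this
    linarith
  have hd : φ q + w ∈ ball (φ p) r := by
    rw [mem_ball, dist_eq_norm, add_sub_right_comm]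
    refine (norm_add_le _ _).trans_lt ?_
    rw [← dist_eq_norm]; linarith
  have hd0 : φ q ∈ ball (φ p) r := by rw [mem_ball]; linarith
  have htar : φ q + w ∈ φ.target := (hball hd).2
  refine ⟨φ.symm (φ q + w), ?_, ?_⟩
  · have := hM.symm_apply_mem_iff htar
    exact this.2 (W.add_mem ((hM.apply_mem_iff hqs).2 hq) hwW)
  · have e1 : φ.symm (φ q + w) - q - u = (φ.symm (φ q + w) - φ.symm (φ q) - B (φ q + w - φ q))
        - (fderiv ℝ φ.symm (φ q) - B) w := by
      rw [φ.left_inv hqs, add_sub_cancel_left, sub_apply,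
        chart_symm_deriv_comp h1 h2 hqs]
      abel
    have e2 : ‖φ.symm (φ q + w) - φ.symm (φ q) - B (φ q + w - φ q)‖ ≤ c * ‖w‖ := by
      have := hVlin (a := (φ q + w, φ q)) ⟨(hball hd).1, (hball hd0).1⟩
      simpa using this
    rw [e1]
    refine (norm_sub_le _ _).trans ?_
    have e3 : ‖(fderiv ℝ φ.symm (φ q) - B) w‖ ≤ c * ‖w‖ :=
      (ContinuousLinearMap.le_opNorm _ _).trans (by gcongr)
    have e4 : c * (‖A‖ + 1) = ε / 2 := by rw [hcdef]; field_simp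
    have e5 := mul_le_mul_of_nonneg_left hwn hcpos.le
    rw [← mul_assoc, e4] at e5
    linarith

variable [FiniteDimensional ℝ E]

/-- Near `q` the set straightened by a `C²` chart deviates only quadratically from its tangent
space at `q`. -/
theorem chart_flat (h1 : ContDiffOn ℝ 2 φ φ.source)
    (h2 : ContDiffOn ℝ 2 φ.symm φ.target) {M : Set E} {W : Submodule ℝ E}
    (hM : φ.IsImage M (W : Set E)) {q : E} (hq : q ∈ φ.source) (hqM : q ∈ M) :
    ∃ C ρ : ℝ, 0 < C ∧ 0 < ρ ∧ ∀ y ∈ M, dist y q < ρ →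
      ‖(chartTangent φ W q)ᗮ.starProjection (y - q)‖ ≤ C * ‖y - q‖ ^ 2 := by
  have hc : ContDiffAt ℝ 2 φ q := h1.contDiffAt (φ.open_source.mem_nhds hq)
  have hc1 : ContDiffAt ℝ 1 (fderiv ℝ φ) q := hc.fderiv_right (by norm_num)
  obtain ⟨K, t, ht, hK⟩ := hc1.exists_lipschitzOnWith
  obtain ⟨ρ, hρ, hball⟩ := Metric.mem_nhds_iff.1 (inter_mem ht (φ.open_source.mem_nhds hq))
  set B := fderiv ℝ φ.symm (φ q)
  refine ⟨‖B‖ * K + 1, ρ, by positivity, hρ, fun y hy hyq => ?_⟩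
  have hys : y ∈ φ.source := (hball hyq).2
  have hT : ‖φ y - φ q - fderiv ℝ φ q (y - q)‖ ≤ K * ‖y - q‖ * ‖y - q‖ := by
    have hsub : closedBall q (dist y q) ⊆ t ∩ φ.source :=
      (closedBall_subset_ball hyq).trans hball
    refine Convex.norm_image_sub_le_of_norm_fderiv_le' (𝕜 := ℝ) (s := closedBall q (dist y q))
      (fun x hx => ?_) (fun x hx => ?_) (convex_closedBall _ _)
      (mem_closedBall_self dist_nonneg) (mem_closedBall.2 le_rfl)
    · exact (h1.contDiffAt (φ.open_source.mem_nhds (hsub hx).2)).differentiableAt (by norm_num)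
    · refine (hK.norm_sub_le (hsub hx).1 (mem_of_mem_nhds ht)).trans ?_
      gcongr
      rw [← dist_eq_norm, ← dist_eq_norm]; exact hx
  set w := φ y - φ q with hw
  have hwW : w ∈ W := W.sub_mem ((hM.apply_mem_iff hys).2 hy) ((hM.apply_mem_iff hq).2 hqM)
  have hBw : B w ∈ chartTangent φ W q := by
    change fderiv ℝ φ q (B w) ∈ W
    rw [chart_deriv_symm_comp h1 h2 hq]; exact hwW
  have e1 : y - q - B w = -B (w - fderiv ℝ φ q (y - q)) := by
    rw [map_sub B w, chart_symm_deriv_comp h1 h2 hq]; abel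
  have e2 : (chartTangent φ W q)ᗮ.starProjection (y - q) =
      (chartTangent φ W q)ᗮ.starProjection (y - q - B w) := by
    rw [map_sub _ (y - q), (Submodule.starProjection_apply_eq_zero_iff _).2
      (Submodule.le_orthogonal_orthogonal _ hBw), sub_zero]
  rw [e2]
  calc _ ≤ ‖y - q - B w‖ := by
        simpa using ((chartTangent φ W q)ᗮ.starProjection).le_of_opNorm_le
          (Submodule.starProjection_norm_le _) (y - q - B w)
    _ ≤ ‖B‖ * (K * ‖y - q‖ * ‖y - q‖) := by
        rw [e1, norm_neg]
        exact (B.le_opNorm _).trans (by gcongr)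
    _ ≤ _ := by nlinarith [sq_nonneg ‖y - q‖]

end Chart

/-- A field of tangent spaces along a `d`-dimensional `C²` submanifold: the submanifold is flat to
second order at each point, and small tangent vectors are approximated by secants, locally
uniformly in the base point. -/
structure TangentField {E : Type*} [NormedAddCommGroup E] [InnerProductSpace ℝ E]
    [FiniteDimensional ℝ E] (d : ℕ) (M : Set E) (T : E → Submodule ℝ E) : Prop where
  finrank_eq : ∀ p ∈ M, Module.finrank ℝ (T p) = d
  flat : ∀ p ∈ M, ∃ C ρ : ℝ, 0 < C ∧ 0 < ρ ∧ ∀ y ∈ M, dist y p < ρ →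
    ‖(T p)ᗮ.starProjection (y - p)‖ ≤ C * ‖y - p‖ ^ 2
  fill : ∀ p ∈ M, ∀ ε > 0, ∃ ρ : ℝ, 0 < ρ ∧ ∀ q ∈ M, dist q p < ρ →
    ∀ u ∈ T q, ‖u‖ < ρ → ∃ p' ∈ M, ‖p' - q - u‖ ≤ ε * ‖u‖

/-- Two candidates for a tangent space at the same point are nested when the set is approximated by
one of them and is flat with respect to the other. -/
theorem tangent_le_of_fill_of_flat {E : Type*} [NormedAddCommGroup E] [InnerProductSpace ℝ E]
    [FiniteDimensional ℝ E] {M : Set E} {q : E} {S T : Submodule ℝ E}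
    (hS : ∀ ε > 0, ∃ ρ : ℝ, 0 < ρ ∧ ∀ u ∈ S, ‖u‖ < ρ → ∃ p' ∈ M, ‖p' - q - u‖ ≤ ε * ‖u‖)
    {C ρ : ℝ} (hC : 0 < C) (hρ : 0 < ρ)
    (hT : ∀ y ∈ M, dist y q < ρ → ‖Tᗮ.starProjection (y - q)‖ ≤ C * ‖y - q‖ ^ 2) : S ≤ T := by
  intro u hu
  rw [← T.orthogonal_orthogonal, ← Submodule.starProjection_apply_eq_zero_iff, ← norm_eq_zero]
  refine le_antisymm (le_of_forall_pos_le_add fun ε hε => ?_) (norm_nonneg _)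
  obtain ⟨c, hc, hc1, hcε⟩ : ∃ c : ℝ, 0 < c ∧ c ≤ 1 ∧ c * ‖u‖ ≤ ε / 2 := by
    refine ⟨min 1 (ε / 2 / (‖u‖ + 1)), by positivity, min_le_left _ _, ?_⟩
    refine (mul_le_mul_of_nonneg_right (min_le_right _ _) (norm_nonneg _)).trans ?_
    rw [div_mul_eq_mul_div, div_le_iff₀ (by positivity)]
    nlinarith [norm_nonneg u]
  obtain ⟨ρ', hρ', hf⟩ := hS c hc
  obtain ⟨t, ht, ht1, ht2, ht3⟩ : ∃ t : ℝ, 0 < t ∧ t * ‖u‖ < ρ' ∧ t * (2 * ‖u‖) < ρ ∧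
      t * (C * (2 * ‖u‖) ^ 2) ≤ ε / 2 := by
    have h : ∀ a b : ℝ, 0 < b → ∀ᶠ t : ℝ in 𝓝[>] 0, t * a < b := by
      intro a b hb
      have : Tendsto (fun t : ℝ => t * a) (𝓝[>] 0) (𝓝 (0 * a)) :=
        (tendsto_id.mono_left nhdsWithin_le_nhds).mul_const a
      rw [zero_mul] at this
      exact this.eventually_lt_const hb
    obtain ⟨t, ⟨⟨⟨h1, h2⟩, h3⟩, h4⟩⟩ := (((h _ _ hρ').and (h _ _ hρ)).and
      (h _ _ (half_pos hε)) |>.and self_mem_nhdsWithin).exists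
    exact ⟨t, h4, h1, h2, h3.le⟩
  have hnt : ‖t • u‖ = t * ‖u‖ := by rw [norm_smul, Real.norm_of_nonneg ht.le]
  obtain ⟨p', hp', hpu⟩ := hf (t • u) (S.smul_mem t hu) (by rw [hnt]; exact ht1)
  have hn : ‖p' - q‖ ≤ t * (2 * ‖u‖) := by
    have := norm_add_le (p' - q - t • u) (t • u)
    rw [sub_add_cancel] at this
    nlinarith [norm_nonneg u, norm_nonneg (t • u)]
  have h1 := hT p' hp' (by rw [dist_eq_norm]; linarith)
  have e : t • u = (p' - q) - (p' - q - t • u) := by abel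
  have h2 : ‖Tᗮ.starProjection (t • u)‖ ≤ C * ‖p' - q‖ ^ 2 + c * (t * ‖u‖) := by
    rw [e, map_sub]
    refine (norm_sub_le _ _).trans (add_le_add h1 ?_)
    refine le_trans ?_ (hnt ▸ hpu)
    simpa using (Tᗮ.starProjection).le_of_opNorm_le (Submodule.starProjection_norm_le _)
      (p' - q - t • u)
  rw [map_smul, norm_smul, Real.norm_of_nonneg ht.le] at h2
  have h3 : ‖p' - q‖ ^ 2 ≤ (t * (2 * ‖u‖)) ^ 2 := pow_le_pow_left₀ (norm_nonneg _) hn 2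
  have h4 : t * ‖Tᗮ.starProjection u‖ ≤ t * ε := by nlinarith
  have := le_of_mul_le_mul_left h4 ht
  linarith

theorem IsC2Submanifold.exists_tangentField {D d : ℕ} {M : Set (EuclideanSpace ℝ (Fin D))}
    (hM : IsC2Submanifold d M) : ∃ T, TangentField d M T := by
  have : Nonempty (OpenPartialHomeomorph (EuclideanSpace ℝ (Fin D)) (EuclideanSpace ℝ (Fin D))) :=
    ⟨OpenPartialHomeomorph.refl _⟩
  choose! φ W hW hp h1 h2 him using hM
  have hflat := fun p (hpM : p ∈ M) q hq hqM =>
    chart_flat (h1 p hpM) (h2 p hpM) (him p hpM) (q := q) hq hqM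
  have hfill := fun p (hpM : p ∈ M) {ε : ℝ} (hε : 0 < ε) =>
    chart_fill (h1 p hpM) (h2 p hpM) (him p hpM) (hp p hpM) hε
  refine ⟨fun p => chartTangent (φ p) (W p) p, fun p hpM => ?_, fun p hpM => ?_,
    fun p hpM ε hε => ?_⟩
  · rw [finrank_chartTangent (h1 p hpM) (h2 p hpM) _ (hp p hpM), hW p hpM]
  · exact hflat p hpM p (hp p hpM) hpM
  · obtain ⟨ρ, hρ, h⟩ := hfill p hpM hε
    refine ⟨ρ, hρ, fun q hqM hqp => ?_⟩
    obtain ⟨hqs, hf⟩ := h q hqM hqp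
    -- the tangent space at `q` does not depend on the chart
    have : chartTangent (φ q) (W q) q = chartTangent (φ p) (W p) q := by
      obtain ⟨C, r, hC, hr, hfl⟩ := hflat p hpM q hqs hqM
      refine Submodule.eq_of_le_of_finrank_eq (tangent_le_of_fill_of_flat ?_ hC hr hfl) ?_
      · intro ε hε
        obtain ⟨ρ, hρ, h⟩ := hfill q hqM hε
        exact ⟨ρ, hρ, (h q hqM (by rwa [dist_self])).2⟩
      · rw [finrank_chartTangent (h1 q hqM) (h2 q hqM) _ (hp q hqM),
          finrank_chartTangent (h1 p hpM) (h2 p hpM) _ hqs, hW p hpM, hW q hqM]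
    rw [this]
    exact hf

/-! ### Angles between tangent spaces -/

section Angle

variable {E : Type*} [NormedAddCommGroup E] [InnerProductSpace ℝ E] [FiniteDimensional ℝ E]

local notation "⟪" x ", " y "⟫" => inner ℝ x y

theorem Submodule.norm_starProjection_le (T : Submodule ℝ E) (v : E) :
    ‖T.starProjection v‖ ≤ ‖v‖ := by
  simpa using T.starProjection.le_of_opNorm_le T.starProjection_norm_le v

theorem Submodule.starProjection_add_compl (T : Submodule ℝ E) (v : E) :
    T.starProjection v + Tᗮ.starProjection v = v :=
  Submodule.starProjection_add_starProjection_orthogonal v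

/-- The bound on the normal parts of tangent vectors dualizes to one on the tangential parts of
normal vectors. -/
theorem norm_starProjection_le_of_perp {S T : Submodule ℝ E} {c : ℝ} (hc : 0 ≤ c)
    (h : ∀ u ∈ T, ‖S.starProjection u‖ ≤ c * ‖u‖) {v : E} (hv : v ∈ S) :
    ‖T.starProjection v‖ ≤ c * ‖v‖ := by
  set u := T.starProjection v with hu
  have h1 : ‖u‖ ^ 2 = ⟪S.starProjection u, v⟫ := by
    have hu' : T.starProjection u = u :=
      Submodule.starProjection_eq_self_iff.2 (T.starProjection_apply_mem v)
    rw [S.inner_starProjection_left_eq_right u v, Submodule.starProjection_eq_self_iff.2 hv]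
    nth_rewrite 2 [← hu']
    rw [T.inner_starProjection_left_eq_right u v, ← hu, real_inner_self_eq_norm_sq]
  have h2 := real_inner_le_norm (S.starProjection u) v
  have h3 := h u (T.starProjection_apply_mem v)
  rcases (norm_nonneg u).eq_or_lt with h0 | h0
  · rw [← h0]; positivity
  · refine le_of_mul_le_mul_right ?_ h0
    nlinarith [mul_le_mul_of_nonneg_right h3 (norm_nonneg v)]

variable {d : ℕ} {M : Set E} {T : E → Submodule ℝ E} {κ : ℝ}

/-- Federer's bound: a set of reach at least `1 / κ` deviates from its tangent space at `p` by at
most `κ / 2` times the squared distance to `p`. -/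
theorem TangentField.norm_perp_le (hT : TangentField d M T) (hM : IsCompact M) (hκ : 0 < κ)
    (hU : UniqueFoot M (1 / κ)) {p y : E} (hp : p ∈ M) (hy : y ∈ M) :
    ‖(T p)ᗮ.starProjection (y - p)‖ ≤ κ / 2 * ‖y - p‖ ^ 2 := by
  set a := (T p)ᗮ.starProjection (y - p) with ha
  rcases (norm_nonneg a).eq_or_lt with h0 | h0
  · rw [← h0]; positivity
  set v := ‖a‖⁻¹ • a with hv
  have hvn : ‖v‖ = 1 := by rw [hv, norm_smul, norm_inv, norm_norm, inv_mul_cancel₀ h0.ne']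
  have hvT : v ∈ (T p)ᗮ := Submodule.smul_mem _ _ (Submodule.starProjection_apply_mem _ _)
  have hproj : ∀ w, ⟪v, w⟫ = ⟪v, (T p)ᗮ.starProjection w⟫ := fun w => by
    rw [← Submodule.inner_starProjection_left_eq_right, Submodule.starProjection_eq_self_iff.2 hvT]
  obtain ⟨C, ρ, hC, hρ, hflat⟩ := hT.flat p hp
  set C' := max C (1 / ρ) with hC'
  have hC'pos : 0 < C' := lt_max_of_lt_left hC
  have hglob : ∀ z ∈ M, ⟪v, z - p⟫ ≤ C' * ‖z - p‖ ^ 2 := by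
    intro z hz
    rcases lt_or_ge (dist z p) ρ with hlt | hge
    · rw [hproj]
      refine (real_inner_le_norm _ _).trans ?_
      rw [hvn, one_mul]
      exact (hflat z hz hlt).trans (by gcongr; exact le_max_left _ _)
    · refine (real_inner_le_norm _ _).trans ?_
      rw [hvn, one_mul]
      rw [dist_eq_norm] at hge
      have h1 : 1 / ρ ≤ C' := le_max_right _ _
      have h2 : 1 ≤ C' * ‖z - p‖ := by
        calc (1 : ℝ) = 1 / ρ * ρ := by field_simp
          _ ≤ _ := by gcongr
      nlinarith [norm_nonneg (z - p)]
  set t := min (1 / (2 * C')) (1 / (2 * κ)) with ht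
  have htpos : 0 < t := by positivity
  have htC : 2 * t * C' ≤ 1 := by
    have : t ≤ 1 / (2 * C') := min_le_left _ _
    rw [le_div_iff₀ (by positivity)] at this
    linarith
  have htκ : t < 1 / κ := by
    refine (min_le_right _ _).trans_lt ?_
    exact one_div_lt_one_div_of_lt hκ (by linarith)
  have hfoot : IsFoot M (p + t • v) p := by
    refine isFoot_iff.2 ⟨hp, fun z hz => ?_⟩
    rw [dist_eq_norm, dist_eq_norm, add_sub_cancel_left]
    have e1 : p + t • v - z = t • v - (z - p) := by abel
    rw [e1]
    refine le_of_sq_le_sq ?_ (norm_nonneg _)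
    rw [norm_sub_sq_real, inner_smul_left]
    simp only [conj_trivial]
    have h1 := mul_le_mul_of_nonneg_left (hglob z hz) htpos.le
    nlinarith [sq_nonneg ‖z - p‖]
  have h1 := hU.inner_le hM hvn htpos htκ hfoot hy
  have h2 : ⟪v, y - p⟫ = ‖a‖ := by
    rw [hproj, ← ha, hv, inner_smul_left, real_inner_self_eq_norm_sq]
    simp only [conj_trivial]
    field_simp
  rw [h2] at h1
  have h3 : κ / 2 * (2 * (1 / κ) * ‖a‖) = ‖a‖ := by field_simp
  nlinarith [mul_le_mul_of_nonneg_left h1 (half_pos hκ).le]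

/-- If tangent vectors at `q` of length `‖q - p‖` are approximated by secants, the angle between the
tangent spaces at `p` and `q` is `O(κ ‖q - p‖)`. The points `p`, `q` and the end point of the secant
all lie close to the tangent space at `p`. -/
theorem TangentField.norm_perp_tangent_le (hT : TangentField d M T) (hM : IsCompact M)
    (hκ : 0 < κ) (hU : UniqueFoot M (1 / κ)) {p q : E} (hp : p ∈ M) (hq : q ∈ M)
    (hfill : ∀ u ∈ T q, ‖u‖ = ‖q - p‖ → ∃ p' ∈ M, ‖p' - q - u‖ ≤ 1 / 10 * ‖u‖) {u : E}
    (hu : u ∈ T q) : ‖(T p)ᗮ.starProjection u‖ ≤ 4 * κ * ‖q - p‖ * ‖u‖ := by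
  set h := ‖q - p‖ with hh
  set S := (T p)ᗮ.starProjection with hS
  set A : T q →L[ℝ] E := S.comp (T q).subtypeL with hA
  have hAu : ∀ w ∈ T q, ‖S w‖ ≤ ‖A‖ * ‖w‖ := fun w hw => A.le_opNorm ⟨w, hw⟩
  have hA0 : 0 ≤ ‖A‖ := norm_nonneg A
  rcases (norm_nonneg (q - p)).eq_or_lt with h0 | h0
  · have hpq : q = p := sub_eq_zero.1 (norm_eq_zero.1 h0.symm)
    have : S u = 0 := by
      rw [hS, Submodule.starProjection_apply_eq_zero_iff, Submodule.orthogonal_orthogonal, ← hpq]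
      exact hu
    rw [this, norm_zero]; positivity
  have key : ∀ w ∈ T q, ‖w‖ = h → ‖S w‖ ≤ (3.31 * κ * h + ‖A‖ / 10) * h := by
    intro w hw hwh
    obtain ⟨p', hp', hpw⟩ := hfill w hw hwh
    rw [hwh] at hpw
    set τ := (T q).starProjection (p' - q) with hτ
    set ν := (T q)ᗮ.starProjection (p' - q) with hν
    have hsum : τ + ν = p' - q := (T q).starProjection_add_compl _
    have e1 : τ - w = (T q).starProjection (p' - q - w) := by
      rw [map_sub _ (p' - q), Submodule.starProjection_eq_self_iff.2 hw]
    have b1 : ‖S (τ - w)‖ ≤ ‖A‖ * (1 / 10 * h) := by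
      refine (hAu _ (by rw [e1]; exact Submodule.starProjection_apply_mem _ _)).trans ?_
      gcongr
      rw [e1]
      exact ((T q).norm_starProjection_le _).trans hpw
    have hn1 : ‖p' - q‖ ≤ 1.1 * h := by
      have := norm_add_le (p' - q - w) w
      rw [sub_add_cancel] at this
      linarith
    have hn2 : ‖p' - p‖ ≤ 2.1 * h := by
      have := norm_add_le (p' - q) (q - p)
      rw [sub_add_sub_cancel] at this
      linarith
    have b2 : ‖S (p' - p)‖ ≤ κ / 2 * (2.1 * h) ^ 2 :=
      (hT.norm_perp_le hM hκ hU hp hp').trans (by gcongr)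
    have b3 : ‖S (q - p)‖ ≤ κ / 2 * h ^ 2 := hT.norm_perp_le hM hκ hU hp hq
    have b4 : ‖S ν‖ ≤ κ / 2 * (1.1 * h) ^ 2 :=
      ((T p)ᗮ.norm_starProjection_le _).trans
        ((hT.norm_perp_le hM hκ hU hq hp').trans (by gcongr))
    have e2 : w = (p' - p) - (q - p) - ν - (τ - w) := by
      have : p' = τ + ν + q := by rw [hsum]; abel
      rw [this]; abel
    have e3 : ‖S w‖ ≤ ‖S (p' - p)‖ + ‖S (q - p)‖ + ‖S ν‖ + ‖S (τ - w)‖ := by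
      have e4 : S w = S (p' - p) - S (q - p) - S ν - S (τ - w) := by
        conv_lhs => rw [e2]
        simp only [map_sub]
      rw [e4]
      refine (norm_sub_le _ _).trans (add_le_add_left ?_ _)
      refine (norm_sub_le _ _).trans (add_le_add_left ?_ _)
      exact norm_sub_le _ _
    nlinarith
  have hbound : ‖A‖ ≤ 3.31 * κ * h + ‖A‖ / 10 := by
    refine A.opNorm_le_bound (by positivity) fun w => ?_
    rcases (norm_nonneg (w : E)).eq_or_lt with hw0 | hw0
    · have : w = 0 := by
        apply Subtype.ext
        exact norm_eq_zero.1 hw0.symm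
      rw [this]; simp
    · have h1 := key ((h / ‖(w : E)‖) • (w : E)) ((T q).smul_mem _ w.2) (by
        rw [norm_smul, Real.norm_of_nonneg (by positivity), div_mul_cancel₀ _ hw0.ne'])
      rw [map_smul, norm_smul, Real.norm_of_nonneg (by positivity), div_mul_eq_mul_div,
        div_le_iff₀ hw0] at h1
      have h2 : h * ‖S w‖ ≤ h * ((3.31 * κ * h + ‖A‖ / 10) * ‖(w : E)‖) := by linarith
      exact le_of_mul_le_mul_left h2 h0
  refine (hAu u hu).trans ?_
  gcongr
  nlinarith [mul_pos hκ h0]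

/-- The distance of two orthogonal projections is bounded by the larger of the two one-sided angles
between the subspaces, since the two contributions to the difference are orthogonal. -/
theorem norm_starProjection_sub_le {S T : Submodule ℝ E} {c : ℝ} (hc : 0 ≤ c)
    (h1 : ∀ u ∈ T, ‖Sᗮ.starProjection u‖ ≤ c * ‖u‖)
    (h2 : ∀ u ∈ S, ‖Tᗮ.starProjection u‖ ≤ c * ‖u‖) (v : E) :
    ‖S.starProjection v - T.starProjection v‖ ≤ c * ‖v‖ := by
  set w := Tᗮ.starProjection v with hw
  set t := T.starProjection v with ht
  have hv : t + w = v := T.starProjection_add_compl v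
  have hts := S.starProjection_add_compl t
  have e : S.starProjection v - t = S.starProjection w - Sᗮ.starProjection t := by
    rw [← hv, map_add]; nth_rewrite 2 [← hts]; abel
  have b1 : ‖S.starProjection w‖ ≤ c * ‖w‖ :=
    norm_starProjection_le_of_perp hc h2 (Submodule.starProjection_apply_mem _ _)
  have b2 : ‖Sᗮ.starProjection t‖ ≤ c * ‖t‖ := h1 t (Submodule.starProjection_apply_mem _ _)
  have horth : ⟪S.starProjection w, Sᗮ.starProjection t⟫ = 0 :=
    Submodule.inner_right_of_mem_orthogonal (Submodule.starProjection_apply_mem _ _)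
      (Submodule.starProjection_apply_mem _ _)
  have hpy := Submodule.norm_sq_eq_add_norm_sq_starProjection v T
  rw [← hw, ← ht] at hpy
  rw [e]
  refine le_of_sq_le_sq ?_ (by positivity)
  rw [norm_sub_sq_real, horth, mul_pow, hpy]
  have c1 := pow_le_pow_left₀ (norm_nonneg _) b1 2
  have c2 := pow_le_pow_left₀ (norm_nonneg _) b2 2
  rw [mul_pow] at c1 c2
  linarith

/-- The tangent spaces at two points of a set of reach at least `1 / κ` form an angle bounded by a
multiple of the distance of the points. The local bound on the angle is integrated along the
projection to `M` of the segment between the points. -/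
theorem TangentField.norm_tangent_normal_le (hT : TangentField d M T) (hM : IsCompact M)
    (hκ : 0 < κ) (hU : UniqueFoot M (1 / κ)) {x y : E} (hx : x ∈ M) (hy : y ∈ M)
    (hxy : κ * ‖y - x‖ < 2) {v : E} (hv : v ∈ (T x)ᗮ) :
    ‖(T y).starProjection v‖ ≤ 4 * κ * ‖y - x‖ / (1 - κ * ‖y - x‖ / 2) * ‖v‖ := by
  set ℓ := ‖y - x‖ with hℓ
  set τ := ℓ / 2 with hτ
  have hτκ : τ < 1 / κ := by rw [lt_div_iff₀ hκ, hτ]; linarith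
  have hden : 0 < 1 - κ * ℓ / 2 := by linarith
  choose γ hγ using fun s : ℝ => hM.exists_isFoot ⟨x, hx⟩ (x + s • (y - x))
  have hdist : ∀ s ∈ Icc (0 : ℝ) 1, infDist (x + s • (y - x)) M ≤ τ := by
    rintro s ⟨hs0, hs1⟩
    rcases le_total s (1 / 2) with hs | hs
    · refine (infDist_le_dist_of_mem hx).trans ?_
      rw [dist_eq_norm, add_sub_cancel_left, norm_smul, Real.norm_of_nonneg hs0, ← hℓ, hτ]
      nlinarith [norm_nonneg (y - x)]
    · refine (infDist_le_dist_of_mem hy).trans ?_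
      have e : x + s • (y - x) - y = (s - 1) • (y - x) := by rw [sub_smul, one_smul]; abel
      rw [dist_eq_norm, e, norm_smul, Real.norm_of_nonpos (by linarith), ← hℓ, hτ]
      nlinarith [norm_nonneg (y - x)]
  have hLip : ∀ s ∈ Icc (0 : ℝ) 1, ∀ s' ∈ Icc (0 : ℝ) 1,
      ‖γ s' - γ s‖ ≤ ℓ / (1 - κ * ℓ / 2) * |s' - s| := by
    intro s hs s' hs'
    have h1 := hU.foot_lipschitz hM hτκ (hdist s' hs') (hdist s hs) (hγ s') (hγ s)
    have e : x + s' • (y - x) - (x + s • (y - x)) = (s' - s) • (y - x) := by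
      rw [sub_smul]; abel
    have e2 : 1 - τ / (1 / κ) = 1 - κ * ℓ / 2 := by rw [hτ]; field_simp
    rw [e, norm_smul, Real.norm_eq_abs, e2, ← hℓ] at h1
    rw [div_mul_eq_mul_div, le_div_iff₀ hden]
    linarith
  set L := ℓ / (1 - κ * ℓ / 2) with hL
  have hL0 : 0 ≤ L := by positivity
  have hγ0 : γ 0 = x := by
    have h := hγ 0
    rw [zero_smul, add_zero] at h
    exact hU x (by rw [infDist_zero_of_mem hx]; positivity) _ _ h (.of_mem hx)
  have hγ1 : γ 1 = y := by
    have h := hγ 1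
    rw [one_smul, add_sub_cancel] at h
    exact hU y (by rw [infDist_zero_of_mem hy]; positivity) _ _ h (.of_mem hy)
  set f : ℝ → ℝ := fun s => ‖(T (γ s)).starProjection v‖ with hf
  have hloc : ∀ s ∈ Icc (0 : ℝ) 1, ∃ δ : ℝ, 0 < δ ∧ ∀ s' ∈ Icc (0 : ℝ) 1, |s' - s| < δ →
      |f s' - f s| ≤ 4 * κ * L * ‖v‖ * |s' - s| := by
    intro s hs
    obtain ⟨ρ, hρ, hfill⟩ := hT.fill (γ s) (hγ s).1 (1 / 10) (by norm_num)
    refine ⟨ρ / (L + 1), by positivity, fun s' hs' hss => ?_⟩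
    have h1 := hLip s hs s' hs'
    have h2 : ‖γ s' - γ s‖ < ρ := by
      rw [lt_div_iff₀ (by positivity)] at hss
      nlinarith [abs_nonneg (s' - s)]
    have h3 : ‖(T (γ s')).starProjection v - (T (γ s)).starProjection v‖
        ≤ 4 * κ * ‖γ s' - γ s‖ * ‖v‖ := by
      refine norm_starProjection_sub_le (by positivity) (fun u hu => ?_) (fun u hu => ?_) v
      · rw [norm_sub_rev]
        refine hT.norm_perp_tangent_le hM hκ hU (hγ s').1 (hγ s).1 (fun u hu hun => ?_) hu
        exact hfill _ (hγ s).1 (by rwa [dist_self]) u hu (by rw [hun, norm_sub_rev]; exact h2)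
      · refine hT.norm_perp_tangent_le hM hκ hU (hγ s).1 (hγ s').1 (fun u hu hun => ?_) hu
        exact hfill _ (hγ s').1 (by rwa [dist_eq_norm]) u hu (by rw [hun]; exact h2)
    refine (abs_norm_sub_norm_le _ _).trans (h3.trans ?_)
    have := mul_le_mul_of_nonneg_left h1 (show 0 ≤ 4 * κ * ‖v‖ by positivity)
    linarith
  have hcont : ContinuousOn f (Icc 0 1) := by
    intro s hs
    obtain ⟨δ, hδ, hb⟩ := hloc s hs
    rw [ContinuousWithinAt, tendsto_iff_dist_tendsto_zero]
    refine squeeze_zero' (g := fun s' => 4 * κ * L * ‖v‖ * |s' - s|)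
      (Eventually.of_forall fun _ => dist_nonneg) ?_ ?_
    · filter_upwards [self_mem_nhdsWithin, mem_nhdsWithin_of_mem_nhds (ball_mem_nhds s hδ)]
        with s' h1 h2
      rw [Real.dist_eq]
      exact hb s' h1 (by rwa [mem_ball, Real.dist_eq] at h2)
    · have : Continuous fun s' : ℝ => 4 * κ * L * ‖v‖ * |s' - s| := by fun_prop
      have h := (this.tendsto s).mono_left (nhdsWithin_le_nhds (s := Icc (0 : ℝ) 1))
      simpa using h
  have hmain := image_le_of_liminf_slope_right_le_deriv_boundary hcont
    (B := fun s => 4 * κ * L * ‖v‖ * s) (B' := fun _ => 4 * κ * L * ‖v‖) (by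
      have : (T x).starProjection v = 0 := (Submodule.starProjection_apply_eq_zero_iff _).2 hv
      simp [hf, hγ0, this]) (by fun_prop)
    (fun s _ => by
      simpa using ((hasDerivAt_id s).const_mul (4 * κ * L * ‖v‖)).hasDerivWithinAt) (by
      intro s hs r hr
      obtain ⟨δ, hδ, hb⟩ := hloc s ⟨hs.1, hs.2.le⟩
      refine Eventually.frequently ?_
      filter_upwards [Ioo_mem_nhdsGT (show s < min 1 (s + δ) from lt_min hs.2 (by linarith))]
        with s' hs'
      have h1 := hb s' ⟨hs.1.trans hs'.1.le, (hs'.2.trans_le (min_le_left _ _)).le⟩ (by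
        rw [abs_of_pos (sub_pos.2 hs'.1)]
        linarith [hs'.2.trans_le (min_le_right _ _)])
      rw [abs_of_pos (sub_pos.2 hs'.1)] at h1
      rw [slope_def_field]
      refine lt_of_le_of_lt ?_ hr
      rw [div_le_iff₀ (sub_pos.2 hs'.1)]
      exact (le_abs_self _).trans h1)
  have h1 := hmain (right_mem_Icc.2 zero_le_one)
  simp only [hf, hγ1, mul_one] at h1
  refine h1.trans (le_of_eq ?_)
  rw [hL]; ring

theorem TangentField.norm_normal_tangent_le (hT : TangentField d M T) (hM : IsCompact M)
    (hκ : 0 < κ) (hU : UniqueFoot M (1 / κ)) {x y : E} (hx : x ∈ M) (hy : y ∈ M)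
    (hxy : κ * ‖y - x‖ < 2) {u : E} (hu : u ∈ T y) :
    ‖(T x)ᗮ.starProjection u‖ ≤ 4 * κ * ‖y - x‖ / (1 - κ * ‖y - x‖ / 2) * ‖u‖ :=
  norm_starProjection_le_of_perp
    (div_nonneg (by positivity) (by linarith))
    (fun _ hv => hT.norm_tangent_normal_le hM hκ hU hx hy hxy hv) hu

/-- Secants of `M` near `x` form a small angle with the tangent space at `x`. -/
theorem TangentField.norm_perp_secant_le (hT : TangentField d M T) (hM : IsCompact M)
    (hκ : 0 < κ) (hU : UniqueFoot M (1 / κ)) {r : ℝ} (hr : 0 < r) (hκr : κ * r ≤ 1 / 48)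
    {x y z : E} (hx : x ∈ M) (hy : y ∈ M) (hz : z ∈ M) (hyx : ‖y - x‖ ≤ 3.25 * r)
    (hzx : ‖z - x‖ ≤ 3.25 * r) :
    ‖(T x)ᗮ.starProjection (z - y)‖ ≤ 17 * (κ * r) * ‖z - y‖ := by
  have hkr : 0 < κ * r := by positivity
  have hκyx : κ * ‖y - x‖ ≤ 3.25 * (κ * r) := by nlinarith
  set S := (T x)ᗮ.starProjection with hS
  set τ := (T y).starProjection (z - y)
  set ν := (T y)ᗮ.starProjection (z - y)
  have hsum : τ + ν = z - y := (T y).starProjection_add_compl _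
  have hzy : ‖z - y‖ ≤ 6.5 * r := by
    have := norm_sub_le (z - x) (y - x)
    rw [sub_sub_sub_cancel_right] at this
    linarith
  have b1 : ‖S ν‖ ≤ 3.25 * (κ * r) * ‖z - y‖ := by
    refine ((T x)ᗮ.norm_starProjection_le _).trans ((hT.norm_perp_le hM hκ hU hy hz).trans ?_)
    nlinarith [mul_le_mul_of_nonneg_left hzy (mul_nonneg hκ.le (norm_nonneg (z - y)))]
  have b2 : ‖S τ‖ ≤ 13.5 * (κ * r) * ‖z - y‖ := by
    refine (hT.norm_normal_tangent_le hM hκ hU hx hy (by linarith)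
      (Submodule.starProjection_apply_mem _ _)).trans ?_
    have h1 : ‖τ‖ ≤ ‖z - y‖ := Submodule.norm_starProjection_le _ _
    have h2 : 4 * κ * ‖y - x‖ / (1 - κ * ‖y - x‖ / 2) ≤ 13.5 * (κ * r) := by
      rw [div_le_iff₀ (by linarith)]
      nlinarith
    gcongr
  rw [← hsum, map_add, hsum]
  refine (norm_add_le _ _).trans ?_
  nlinarith [mul_nonneg hkr.le (norm_nonneg (z - y))]

/-- A point of `M` near `x` is not much farther from `x` than its tangential projection. -/
theorem TangentField.norm_le_of_norm_proj_le (hT : TangentField d M T) (hM : IsCompact M)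
    (hκ : 0 < κ) (hU : UniqueFoot M (1 / κ)) {r : ℝ} (hκr : κ * r ≤ 1 / 48)
    {x p : E} (hx : x ∈ M) (hp : p ∈ M) (hpx : ‖p - x‖ ≤ 6.5 * r) {a : ℝ}
    (ha : ‖(T x).starProjection (p - x)‖ ≤ a) : ‖p - x‖ ≤ 1.08 * a := by
  have h1 := hT.norm_perp_le hM hκ hU hx hp
  have h2 : κ / 2 * ‖p - x‖ ^ 2 ≤ 0.068 * ‖p - x‖ := by
    nlinarith [mul_le_mul_of_nonneg_left hpx (mul_nonneg hκ.le (norm_nonneg (p - x))),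
      norm_nonneg (p - x)]
  have h3 := norm_add_le ((T x).starProjection (p - x)) ((T x)ᗮ.starProjection (p - x))
  rw [(T x).starProjection_add_compl] at h3
  have := norm_nonneg (p - x)
  linarith

/-- The projection of `M` to its tangent space at `x` covers a ball. The preimage of `z` is found by
minimizing the distance of the projection to `z`: at a minimizer with a positive distance,
the projection from the tangent space there would be onto, and moving along `M` would decrease the
distance. -/
theorem TangentField.exists_proj_eq (hT : TangentField d M T) (hM : IsCompact M)
    (hκ : 0 < κ) (hU : UniqueFoot M (1 / κ)) {r : ℝ} (hr : 0 < r) (hκr : κ * r ≤ 1 / 48)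
    {x z : E} (hx : x ∈ M) (hz : z ∈ T x) (hzr : ‖z‖ ≤ 3 * r) :
    ∃ p ∈ M, (T x).starProjection (p - x) = z ∧ ‖p - x‖ ≤ 3.25 * r := by
  set P := (T x).starProjection with hP
  obtain ⟨p, ⟨hpM, hpx⟩, hmin⟩ := (hM.inter_right (isClosed_closedBall (x := x) (ε := 6.5 * r))).exists_isMinOn
    (f := fun p => ‖P (p - x) - z‖) ⟨x, hx, mem_closedBall_self (by positivity)⟩ (by fun_prop)
  rw [mem_closedBall, dist_eq_norm] at hpx
  have h0 : ‖P (p - x) - z‖ ≤ ‖z‖ := by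
    have := hmin ⟨hx, mem_closedBall_self (by positivity)⟩
    simpa using this
  have h1 : ‖P (p - x)‖ ≤ 2 * ‖z‖ := by
    have := norm_add_le (P (p - x) - z) z
    rw [sub_add_cancel] at this
    linarith
  have h2 := hT.norm_le_of_norm_proj_le hM hκ hU hκr hx hpM hpx h1
  have hlt : ‖p - x‖ < 6.5 * r := by linarith
  suffices heq : P (p - x) = z by
    refine ⟨p, hpM, heq, ?_⟩
    have := hT.norm_le_of_norm_proj_le hM hκ hU hκr hx hpM hpx (a := ‖z‖) (le_of_eq (by rw [← heq]))
    linarith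
  by_contra hne
  set e := z - P (p - x) with he
  have he0 : 0 < ‖e‖ := norm_pos_iff.2 (sub_ne_zero.2 (Ne.symm hne))
  have heT : e ∈ T x := (T x).sub_mem hz (Submodule.starProjection_apply_mem _ _)
  have hk : κ * ‖p - x‖ ≤ 6.5 * (κ * r) := by nlinarith
  -- the projection from `T p` to `T x` is injective, hence bijective
  have hsurj : ∃ u ∈ T p, P u = e := by
    let F : T p →ₗ[ℝ] T x := ((T x).orthogonalProjectionOnto : E →ₗ[ℝ] T x).comp (T p).subtype
    have hF : ∀ u, ((F u : T x) : E) = P u := fun u => rfl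
    have hinj : Function.Injective F := by
      rw [injective_iff_map_eq_zero]
      intro u hu
      have h3 : P u = 0 := by rw [← hF, hu]; rfl
      have h4 := hT.norm_normal_tangent_le hM hκ hU hx hpM (by linarith) u.2
      have h5 := (T x).starProjection_add_compl (u : E)
      rw [← hP, h3, zero_add] at h5
      rw [h5] at h4
      have h6 : 4 * κ * ‖p - x‖ / (1 - κ * ‖p - x‖ / 2) ≤ 0.6 := by
        rw [div_le_iff₀ (by linarith)]
        linarith
      have h7 : ‖(u : E)‖ ≤ 0 := by nlinarith [norm_nonneg (u : E)]
      exact Subtype.ext (norm_le_zero_iff.1 h7)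
    have hfr : Module.finrank ℝ (T p) = Module.finrank ℝ (T x) := by
      rw [hT.finrank_eq p hpM, hT.finrank_eq x hx]
    obtain ⟨u, hu⟩ := (LinearMap.injective_iff_surjective_of_finrank_eq_finrank hfr).1 hinj ⟨e, heT⟩
    exact ⟨u, u.2, by rw [← hF, hu]⟩
  obtain ⟨u, huT, hue⟩ := hsurj
  have hu0 : 0 < ‖u‖ := by
    rw [norm_pos_iff]; rintro rfl
    rw [map_zero] at hue
    rw [← hue, norm_zero] at he0
    exact lt_irrefl _ he0
  obtain ⟨ρ, hρ, hfill⟩ := hT.fill p hpM (‖e‖ / (2 * ‖u‖)) (by positivity)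
  obtain ⟨t, ht0, ht1, ht2, ht3⟩ : ∃ t : ℝ, 0 < t ∧ t ≤ 1 ∧ t * ‖u‖ < ρ ∧
      t * (‖u‖ + ‖e‖) < 6.5 * r - ‖p - x‖ := by
    have h : ∀ a b : ℝ, 0 < b → ∀ᶠ t : ℝ in 𝓝[>] 0, t * a < b := by
      intro a b hb
      have : Tendsto (fun t : ℝ => t * a) (𝓝[>] 0) (𝓝 (0 * a)) :=
        (tendsto_id.mono_left nhdsWithin_le_nhds).mul_const a
      rw [zero_mul] at this
      exact this.eventually_lt_const hb
    obtain ⟨t, ⟨⟨h1, h2⟩, h3⟩, h4⟩ := (((h 1 1 one_pos).and (h ‖u‖ ρ hρ)).and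
      (h (‖u‖ + ‖e‖) _ (sub_pos.2 hlt)) |>.and self_mem_nhdsWithin).exists
    exact ⟨t, h4, by linarith, h2, h3⟩
  obtain ⟨p', hp', hpu⟩ := hfill p hpM (by rwa [dist_self]) (t • u) ((T p).smul_mem _ huT) (by
    rwa [norm_smul, Real.norm_of_nonneg ht0.le])
  have hw : ‖p' - p - t • u‖ ≤ t * ‖e‖ / 2 := by
    refine hpu.trans (le_of_eq ?_)
    rw [norm_smul, Real.norm_of_nonneg ht0.le]
    field_simp
  have hp'x : ‖p' - x‖ ≤ 6.5 * r := by
    have e1 : p' - x = (p' - p - t • u) + t • u + (p - x) := by abel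
    rw [e1]
    refine (norm_add₃_le).trans ?_
    rw [norm_smul, Real.norm_of_nonneg ht0.le]
    nlinarith
  have h3 := hmin ⟨hp', by rw [mem_closedBall, dist_eq_norm]; exact hp'x⟩
  have h3 : ‖P (p - x) - z‖ ≤ ‖P (p' - x) - z‖ := h3
  rw [norm_sub_rev, ← he] at h3
  have e2 : P (p' - x) - z = P (p' - p - t • u) - (1 - t) • e := by
    have e3 : p' - x = (p' - p - t • u) + t • u + (p - x) := by abel
    rw [e3, map_add, map_add, map_smul, hue, sub_smul, one_smul, he]
    abel
  rw [e2] at h3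
  have h4 := norm_sub_le (P (p' - p - t • u)) ((1 - t) • e)
  rw [norm_smul, Real.norm_of_nonneg (by linarith)] at h4
  have h5 := ((T x).norm_starProjection_le (p' - p - t • u)).trans hw
  rw [← hP] at h5
  nlinarith

end Angle

/-! ### The volume of a lens -/

/-- Up to normalization, the volume of the intersection of two unit balls in dimension
`d ≥ 1` whose centers have distance `2 a`. -/
noncomputable def lensProfile (d : ℕ) (a : ℝ) : ℝ :=
  ∫ u in a..1, (1 - u ^ 2) ^ (((d : ℝ) - 1) / 2)

theorem incompleteBeta_eq_lensProfile (d : ℕ) {a : ℝ} (ha0 : 0 ≤ a) (ha1 : a ≤ 1) :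
    incompleteBeta (1 - a ^ 2) (((d : ℝ) + 1) / 2) (1 / 2) = 2 * lensProfile d a := by
  have ha : (0 : ℝ) ≤ 1 - a ^ 2 := by nlinarith
  rw [incompleteBeta, lensProfile, intervalIntegral.integral_of_le ha,
    intervalIntegral.integral_of_le ha1, integral_Ioc_eq_integral_Ioo, integral_Ioc_eq_integral_Ioo,
    ← integral_const_mul]
  have himg : (fun u : ℝ => 1 - u ^ 2) '' Ioo a 1 = Ioo 0 (1 - a ^ 2) := by
    ext t
    constructor
    · rintro ⟨u, ⟨h1, h2⟩, rfl⟩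
      have h0 : 0 ≤ u := ha0.trans h1.le
      constructor
      · change 0 < 1 - u ^ 2; nlinarith
      · change 1 - u ^ 2 < 1 - a ^ 2; nlinarith
    · rintro ⟨h1, h2⟩
      refine ⟨Real.sqrt (1 - t), ⟨?_, ?_⟩, ?_⟩
      · rw [Real.lt_sqrt ha0]; linarith
      · rw [Real.sqrt_lt' one_pos]; linarith
      · change 1 - Real.sqrt (1 - t) ^ 2 = t
        rw [Real.sq_sqrt (by nlinarith [sq_nonneg a])]; ring
  rw [← himg, integral_image_eq_integral_abs_deriv_smul (f' := fun u => -(2 * u)) measurableSet_Ioo]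
  · refine setIntegral_congr_fun measurableSet_Ioo fun u hu => ?_
    have hu0 : 0 < u := ha0.trans_lt hu.1
    have e1 : ((d : ℝ) + 1) / 2 - 1 = ((d : ℝ) - 1) / 2 := by ring
    have e2 : (1 - (1 - u ^ 2)) ^ ((1 : ℝ) / 2 - 1) = u⁻¹ := by
      rw [sub_sub_cancel, ← Real.rpow_natCast, ← Real.rpow_mul hu0.le]
      norm_num
      rw [Real.rpow_neg_one]
    simp only [smul_eq_mul, e1, e2, abs_neg, abs_of_pos (mul_pos two_pos hu0)]
    field_simp
  · intro u _
    have := ((hasDerivAt_pow 2 u).const_sub 1).hasDerivWithinAt (s := Ioo a 1)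
    simpa using this
  · intro u hu w hw h
    have hu0 : 0 < u := ha0.trans_lt hu.1
    have hw0 : 0 < w := ha0.trans_lt hw.1
    have h : 1 - u ^ 2 = 1 - w ^ 2 := h
    exact (pow_left_inj₀ hu0.le hw0.le two_ne_zero).1 (by linarith)

section Volume

theorem lens_integral (n : ℕ) {ρ τ : ℝ} (hρ : 0 < ρ) (hτ : 0 ≤ τ) (hτρ : τ ≤ 2 * ρ) :
    ∫ u in (τ - ρ)..ρ, (ρ ^ 2 - max (u ^ 2) ((u - τ) ^ 2)) ^ ((n : ℝ) / 2) =
      2 * ρ ^ (n + 1) * lensProfile (n + 1) (τ / (2 * ρ)) := by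
  set g : ℝ → ℝ := fun u => (ρ ^ 2 - max (u ^ 2) ((u - τ) ^ 2)) ^ ((n : ℝ) / 2) with hg
  set G : ℝ → ℝ := fun u => (ρ ^ 2 - u ^ 2) ^ ((n : ℝ) / 2) with hG
  have hgc : Continuous g := Continuous.rpow_const (by fun_prop) fun _ => Or.inr (by positivity)
  have h1 : ∫ u in (τ / 2)..ρ, g u = ∫ u in (τ / 2)..ρ, G u := by
    refine intervalIntegral.integral_congr fun u hu => ?_
    rw [uIcc_of_le (by linarith)] at hu
    have : (u - τ) ^ 2 ≤ u ^ 2 := by nlinarith [hu.1]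
    simp only [hg, hG, max_eq_left this]
  have h2 : ∫ u in (τ - ρ)..(τ / 2), g u = ∫ u in (τ / 2)..ρ, g u := by
    have h := intervalIntegral.integral_comp_sub_left (a := τ / 2) (b := ρ) g τ
    rw [show τ - τ / 2 = τ / 2 by ring] at h
    rw [← h]
    refine intervalIntegral.integral_congr fun u _ => ?_
    simp only [hg]
    rw [max_comm, show (τ - u - τ) ^ 2 = u ^ 2 by ring, show (τ - u) ^ 2 = (u - τ) ^ 2 by ring]
  have h3 : ∫ u in (τ / 2)..ρ, G u = ρ ^ (n + 1) * lensProfile (n + 1) (τ / (2 * ρ)) := by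
    have h := intervalIntegral.mul_integral_comp_mul_left (a := τ / (2 * ρ)) (b := 1) (f := G) ρ
    rw [show ρ * (τ / (2 * ρ)) = τ / 2 by field_simp, mul_one] at h
    rw [← h, pow_succ', mul_assoc]
    congr 1
    rw [lensProfile, ← intervalIntegral.integral_const_mul]
    refine intervalIntegral.integral_congr fun u hu => ?_
    have hle : τ / (2 * ρ) ≤ 1 := by rw [div_le_one (by positivity)]; exact hτρ
    rw [uIcc_of_le hle] at hu
    have hu0 : 0 ≤ u := le_trans (by positivity) hu.1
    have hu1 : 0 ≤ 1 - u ^ 2 := by nlinarith [hu.2]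
    have e : (((n + 1 : ℕ) : ℝ) - 1) / 2 = (n : ℝ) / 2 := by push_cast; ring
    simp only [hG, e]
    rw [show ρ ^ 2 - (ρ * u) ^ 2 = ρ ^ 2 * (1 - u ^ 2) by ring, Real.mul_rpow (sq_nonneg ρ) hu1]
    congr 1
    rw [← Real.rpow_natCast ρ 2, ← Real.rpow_mul hρ.le]
    rw [show ((2 : ℕ) : ℝ) * ((n : ℝ) / 2) = n by push_cast; ring, Real.rpow_natCast]
  rw [← intervalIntegral.integral_add_adjacent_intervals (b := τ / 2)
    (hgc.intervalIntegrable _ _) (hgc.intervalIntegrable _ _), h2, h1, h3]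
  ring

/-- The volume of a ball in `Fin n → ℝ` for the Euclidean norm. -/
theorem volume_sum_sq_le (n : ℕ) {t : ℝ} (ht : 0 ≤ t) :
    volume {w : Fin n → ℝ | ∑ i, w i ^ 2 ≤ t} =
      ENNReal.ofReal (t ^ ((n : ℝ) / 2)) * volume (ball (0 : EuclideanSpace ℝ (Fin n)) 1) := by
  have h1 := (EuclideanSpace.volume_preserving_symm_measurableEquiv_toLp
    (Fin n)).measure_preimage_equiv {w : Fin n → ℝ | ∑ i, w i ^ 2 ≤ t}
  have h2 : (MeasurableEquiv.toLp 2 (Fin n → ℝ)).symm ⁻¹' {w : Fin n → ℝ | ∑ i, w i ^ 2 ≤ t} =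
      closedBall (0 : EuclideanSpace ℝ (Fin n)) (Real.sqrt t) := by
    rw [EuclideanSpace.closedBall_zero_eq _ (Real.sqrt_nonneg t), Real.sq_sqrt ht]
    rfl
  rw [← h1, h2, Measure.addHaar_closedBall _ _ (Real.sqrt_nonneg t), finrank_euclideanSpace_fin,
    Real.sqrt_eq_rpow, ← Real.rpow_natCast, ← Real.rpow_mul ht]
  congr 3
  ring

/-- The volume of the lens with centers `0` and `τ e₀`, by Fubini's theorem in the direction of the
axis. -/
theorem volume_lens_single (n : ℕ) {ρ τ : ℝ} (hρ : 0 < ρ) (hτ : 0 ≤ τ) (hτρ : τ ≤ 2 * ρ) :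
    volume (closedBall (0 : EuclideanSpace ℝ (Fin (n + 1))) ρ ∩
        closedBall (EuclideanSpace.single 0 τ) ρ) =
      ENNReal.ofReal (2 * ρ ^ (n + 1) * lensProfile (n + 1) (τ / (2 * ρ))) *
        volume (ball (0 : EuclideanSpace ℝ (Fin n)) 1) := by
  set c := volume (ball (0 : EuclideanSpace ℝ (Fin n)) 1) with hc
  set S : Set (ℝ × (Fin n → ℝ)) :=
    {z | z.1 ^ 2 + ∑ i, z.2 i ^ 2 ≤ ρ ^ 2 ∧ (z.1 - τ) ^ 2 + ∑ i, z.2 i ^ 2 ≤ ρ ^ 2} with hS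
  have hSm : MeasurableSet S := by
    rw [hS, ofPred_and]
    refine IsClosed.measurableSet (IsClosed.inter (isClosed_le ?_ ?_) (isClosed_le ?_ ?_)) <;> fun_prop
  have e1 := (EuclideanSpace.volume_preserving_symm_measurableEquiv_toLp (Fin (n + 1))).trans
    (volume_preserving_piFinSuccAbove (fun _ : Fin (n + 1) => ℝ) 0)
  have h1 := e1.measure_preimage hSm.nullMeasurableSet
  have hpre : ((MeasurableEquiv.toLp 2 (Fin (n + 1) → ℝ)).symm.trans
      (MeasurableEquiv.piFinSuccAbove (fun _ : Fin (n + 1) => ℝ) 0)) ⁻¹' S =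
      closedBall (0 : EuclideanSpace ℝ (Fin (n + 1))) ρ ∩
        closedBall (EuclideanSpace.single 0 τ) ρ := by
    ext x
    have hx : ∀ y : EuclideanSpace ℝ (Fin (n + 1)), x ∈ closedBall y ρ ↔
        (x 0 - y 0) ^ 2 + ∑ i : Fin n, (x i.succ - y i.succ) ^ 2 ≤ ρ ^ 2 := by
      intro y
      rw [mem_closedBall, EuclideanSpace.dist_eq, Real.sqrt_le_left hρ.le, Fin.sum_univ_succ]
      simp only [Real.dist_eq, sq_abs]
    rw [mem_inter_iff, hx, hx]
    simp [hS, MeasurableEquiv.piFinSuccAbove_apply, Fin.tail]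
  have h2 : ∀ u : ℝ, volume (Prod.mk u ⁻¹' S) = (Icc (τ - ρ) ρ).indicator (fun u =>
      ENNReal.ofReal ((ρ ^ 2 - max (u ^ 2) ((u - τ) ^ 2)) ^ ((n : ℝ) / 2)) * c) u := by
    intro u
    have e2 : Prod.mk u ⁻¹' S =
        {w : Fin n → ℝ | ∑ i, w i ^ 2 ≤ ρ ^ 2 - max (u ^ 2) ((u - τ) ^ 2)} := by
      ext w
      simp only [hS, mem_preimage, mem_ofPred_eq]
      rw [le_sub_comm, max_le_iff]
      constructor <;> rintro ⟨a, b⟩ <;> constructor <;> linarith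
    rw [e2]
    by_cases hu : u ∈ Icc (τ - ρ) ρ
    · rw [indicator_of_mem hu, volume_sum_sq_le]
      rw [sub_nonneg, max_le_iff]
      constructor <;> nlinarith [hu.1, hu.2]
    · rw [indicator_of_notMem hu]
      refine measure_mono_null (fun w hw => hu ?_) measure_empty
      have hw : ∑ i, w i ^ 2 ≤ ρ ^ 2 - max (u ^ 2) ((u - τ) ^ 2) := hw
      have h0 : 0 ≤ ∑ i, w i ^ 2 := Finset.sum_nonneg fun i _ => sq_nonneg _
      have h3 := le_max_left (u ^ 2) ((u - τ) ^ 2)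
      have h4 := le_max_right (u ^ 2) ((u - τ) ^ 2)
      have h5 := abs_le_of_sq_le_sq' (a := u) (b := ρ) (by linarith) hρ.le
      have h6 := abs_le_of_sq_le_sq' (a := u - τ) (b := ρ) (by linarith) hρ.le
      exact ⟨by linarith [h6.1], h5.2⟩
  have hgc : Continuous fun u : ℝ => (ρ ^ 2 - max (u ^ 2) ((u - τ) ^ 2)) ^ ((n : ℝ) / 2) :=
    Continuous.rpow_const (by fun_prop) fun _ => Or.inr (by positivity)
  rw [← hpre, h1, Measure.volume_eq_prod, Measure.prod_apply hSm, lintegral_congr h2,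
    lintegral_indicator measurableSet_Icc, lintegral_mul_const _ (by fun_prop),
    ← lens_integral n hρ hτ hτρ, intervalIntegral.integral_of_le (by linarith),
    ← integral_Icc_eq_integral_Ioc, ofReal_integral_eq_lintegral_ofReal]
  · exact hgc.continuousOn.integrableOn_compact isCompact_Icc
  · refine (ae_restrict_iff' measurableSet_Icc).2 (Eventually.of_forall fun u hu => ?_)
    refine Real.rpow_nonneg ?_ _
    rw [sub_nonneg, max_le_iff]
    constructor <;> nlinarith [hu.1, hu.2]

end Volume

section Profile

variable {d : ℕ}

theorem lensProfile_integrand_continuous (hd : 1 ≤ d) :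
    Continuous fun u : ℝ => (1 - u ^ 2) ^ (((d : ℝ) - 1) / 2) :=
  Continuous.rpow_const (by fun_prop) fun _ => Or.inr (by
    have : (1 : ℝ) ≤ d := by exact_mod_cast hd
    linarith)

theorem lensProfile_sub (hd : 1 ≤ d) (α β : ℝ) :
    lensProfile d α - lensProfile d β = ∫ u in α..β, (1 - u ^ 2) ^ (((d : ℝ) - 1) / 2) := by
  have h := lensProfile_integrand_continuous hd
  rw [lensProfile, lensProfile, intervalIntegral.integral_interval_sub_interval_comm'
    (h.intervalIntegrable _ _) (h.intervalIntegrable _ _) (h.intervalIntegrable _ _),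
    intervalIntegral.integral_same, zero_sub, intervalIntegral.integral_symm, neg_neg]

theorem lensProfile_anti (hd : 1 ≤ d) {α β : ℝ} (hα : 0 ≤ α) (hαβ : α ≤ β) (hβ : β ≤ 1) :
    lensProfile d β ≤ lensProfile d α := by
  rw [← sub_nonneg, lensProfile_sub hd]
  refine intervalIntegral.integral_nonneg hαβ fun u hu => Real.rpow_nonneg ?_ _
  nlinarith [hu.1, hu.2]

theorem lensProfile_sub_le (hd : 1 ≤ d) {α β : ℝ} (hα : 0 ≤ α) (hαβ : α ≤ β) (hβ : β ≤ 1) :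
    lensProfile d α - lensProfile d β ≤ β - α := by
  rw [lensProfile_sub hd]
  have hd' : (1 : ℝ) ≤ d := by exact_mod_cast hd
  have : ∫ u in α..β, (1 - u ^ 2) ^ (((d : ℝ) - 1) / 2) ≤ ∫ _ in α..β, (1 : ℝ) := by
    refine intervalIntegral.integral_mono_on hαβ
      ((lensProfile_integrand_continuous hd).intervalIntegrable _ _)
      (continuous_const.intervalIntegrable _ _) fun u hu => ?_
    refine Real.rpow_le_one ?_ ?_ (by linarith) <;> nlinarith [hu.1, hu.2]
  simpa using this

theorem le_lensProfile (hd : 1 ≤ d) {a : ℝ} (ha : 0 ≤ a) (ha1 : a ≤ 1) :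
    (1 - a ^ 2) ^ (((d : ℝ) + 1) / 2) / (d + 1) ≤ lensProfile d a := by
  have hd' : (1 : ℝ) ≤ d := by exact_mod_cast hd
  have hc := lensProfile_integrand_continuous hd
  have h1 : ∫ u in a..1, u * (1 - u ^ 2) ^ (((d : ℝ) - 1) / 2) =
      (1 - a ^ 2) ^ (((d : ℝ) + 1) / 2) / (d + 1) := by
    have hder : ∀ u ∈ uIcc a 1, HasDerivAt
        (fun u : ℝ => -((1 - u ^ 2) ^ (((d : ℝ) + 1) / 2) / (d + 1)))
        (u * (1 - u ^ 2) ^ (((d : ℝ) - 1) / 2)) u := by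
      intro u _
      have h2 := ((((hasDerivAt_pow 2 u).const_sub 1).rpow_const (p := ((d : ℝ) + 1) / 2)
        (Or.inr (by linarith))).div_const ((d : ℝ) + 1)).neg
      refine h2.congr_deriv ?_
      rw [show ((d : ℝ) + 1) / 2 - 1 = ((d : ℝ) - 1) / 2 by ring]
      push_cast
      field_simp
    rw [intervalIntegral.integral_eq_sub_of_hasDerivAt hder
      ((continuous_id.mul hc).intervalIntegrable _ _)]
    rw [one_pow, sub_self, Real.zero_rpow (by linarith)]
    ring
  rw [← h1, lensProfile]
  refine intervalIntegral.integral_mono_on ha1 ((continuous_id.mul hc).intervalIntegrable _ _)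
    (hc.intervalIntegrable _ _) fun u hu => ?_
  refine mul_le_of_le_one_left (Real.rpow_nonneg ?_ _) hu.2
  nlinarith [hu.1, hu.2]

theorem lensProfile_pos (hd : 1 ≤ d) {a : ℝ} (ha : 0 ≤ a) (ha1 : a < 1) : 0 < lensProfile d a := by
  refine lt_of_lt_of_le ?_ (le_lensProfile hd ha ha1.le)
  have : 0 < 1 - a ^ 2 := by nlinarith
  positivity

end Profile

section Hausdorff

variable {V : Type*} [NormedAddCommGroup V] [InnerProductSpace ℝ V] [FiniteDimensional ℝ V]
  [MeasurableSpace V] [BorelSpace V]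

/-- The Hausdorff measure of a lens in a Euclidean space of dimension `d`. -/
theorem hausdorffMeasure_lens {d : ℕ} (hd : 1 ≤ d) (hV : Module.finrank ℝ V = d) :
    ∃ c : ℝ, 0 < c ∧ ∀ ρ : ℝ, 0 < ρ → ∀ y : V, ‖y‖ ≤ 2 * ρ →
      Measure.hausdorffMeasure (d : ℝ) (closedBall (0 : V) ρ ∩ closedBall y ρ) =
        ENNReal.ofReal (c * ρ ^ d * lensProfile d (‖y‖ / (2 * ρ))) := by
  obtain ⟨n, rfl⟩ : ∃ n, d = n + 1 := ⟨d - 1, by omega⟩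
  set H : Measure (EuclideanSpace ℝ (Fin (n + 1))) :=
    Measure.hausdorffMeasure ((n + 1 : ℕ) : ℝ) with hH
  have hHaar : H.IsAddHaarMeasure := by
    have := isAddHaarMeasure_hausdorffMeasure (E := EuclideanSpace ℝ (Fin (n + 1)))
    rwa [finrank_euclideanSpace_fin] at this
  have hsm := Measure.isAddLeftInvariant_eq_smul H volume
  have hkpos := Measure.addHaarScalarFactor_pos_of_isAddHaarMeasure H volume
  set k := Measure.addHaarScalarFactor H volume
  set w := volume (ball (0 : EuclideanSpace ℝ (Fin n)) 1) with hw
  have hwpos : 0 < w := measure_ball_pos _ _ one_pos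
  have hwtop : w ≠ ⊤ := measure_ball_lt_top.ne
  refine ⟨2 * k * w.toReal, by
    have := ENNReal.toReal_pos hwpos.ne' hwtop
    have : (0 : ℝ) < k := hkpos
    positivity, fun ρ hρ y hy => ?_⟩
  let L : V ≃ₗᵢ[ℝ] EuclideanSpace ℝ (Fin (n + 1)) :=
    ((stdOrthonormalBasis ℝ V).reindex (finCongr hV)).repr
  have hnorm : ‖L y‖ = ‖(EuclideanSpace.single 0 ‖y‖ : EuclideanSpace ℝ (Fin (n + 1)))‖ := by
    rw [L.norm_map, PiLp.norm_single, norm_norm]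
  let K := L.trans (Submodule.reflection
    (ℝ ∙ (L y - (EuclideanSpace.single 0 ‖y‖ : EuclideanSpace ℝ (Fin (n + 1)))))ᗮ)
  have hKy : K y = EuclideanSpace.single 0 ‖y‖ := Submodule.reflection_sub hnorm
  have himg : K.toIsometryEquiv '' (closedBall (0 : V) ρ ∩ closedBall y ρ) =
      closedBall 0 ρ ∩ closedBall (EuclideanSpace.single 0 ‖y‖) ρ := by
    rw [image_inter K.toIsometryEquiv.injective, IsometryEquiv.image_closedBall, IsometryEquiv.image_closedBall]
    change closedBall (K 0) ρ ∩ closedBall (K y) ρ = _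
    rw [hKy, map_zero]
  rw [← IsometryEquiv.hausdorffMeasure_image K.toIsometryEquiv, himg]
  change H _ = _
  rw [hsm, Measure.smul_apply, volume_lens_single n hρ (norm_nonneg y) hy, ← hw,
    ← ENNReal.ofReal_toReal hwtop, ENNReal.toReal_ofReal ENNReal.toReal_nonneg]
  have hnn : 0 ≤ lensProfile (n + 1) (‖y‖ / (2 * ρ)) := by
    have h1 : ‖y‖ / (2 * ρ) ≤ 1 := by rw [div_le_one (by positivity)]; exact hy
    have := lensProfile_anti (d := n + 1) hd (α := ‖y‖ / (2 * ρ)) (by positivity) h1 le_rfl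
    simpa [lensProfile] using this
  rw [ENNReal.smul_def, smul_eq_mul, ← ENNReal.ofReal_coe_nnreal, ← ENNReal.ofReal_mul (by positivity),
    ← ENNReal.ofReal_mul (by positivity)]
  congr 1
  ring

end Hausdorff

/-! ### Comparison of the manifold with its tangent space -/

section Compare

variable {E : Type*} [NormedAddCommGroup E] [InnerProductSpace ℝ E] [FiniteDimensional ℝ E]
  {d : ℕ} {M : Set E} {T : E → Submodule ℝ E} {κ r : ℝ}

/-- The orthogonal projection to the affine tangent space at `x`, with `x` as the origin. -/
noncomputable def tangentProj (T : E → Submodule ℝ E) (x p : E) : T x :=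
  (T x).orthogonalProjectionOnto (p - x)

theorem tangentProj_coe (x p : E) :
    (tangentProj T x p : E) = (T x).starProjection (p - x) := rfl

theorem coe_tangentProj_sub (x p q : E) :
    ((tangentProj T x p - tangentProj T x q : T x) : E) = (T x).starProjection (p - q) := by
  rw [Submodule.coe_sub, tangentProj_coe, tangentProj_coe, ← map_sub, sub_sub_sub_cancel_right]

theorem norm_tangentProj_sub_le (x p q : E) :
    ‖tangentProj T x p - tangentProj T x q‖ ≤ ‖p - q‖ := by
  rw [Submodule.coe_norm, coe_tangentProj_sub]
  exact Submodule.norm_starProjection_le _ _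

theorem tangentProj_self (x : E) : tangentProj T x x = 0 := by
  rw [tangentProj, sub_self, map_zero]

theorem norm_sq_eq_tangentProj (x p q : E) : ‖p - q‖ ^ 2 =
    ‖tangentProj T x p - tangentProj T x q‖ ^ 2 + ‖(T x)ᗮ.starProjection (p - q)‖ ^ 2 := by
  rw [Submodule.coe_norm, coe_tangentProj_sub]
  exact Submodule.norm_sq_eq_add_norm_sq_starProjection _ _

/-- The tangential projection is bi-Lipschitz near `x`. -/
theorem TangentField.norm_sub_le_tangentProj (hT : TangentField d M T) (hM : IsCompact M)
    (hκ : 0 < κ) (hU : UniqueFoot M (1 / κ)) (hr : 0 < r) (hκr : κ * r ≤ 1 / 48)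
    {x y z : E} (hx : x ∈ M) (hy : y ∈ M) (hz : z ∈ M) (hyx : ‖y - x‖ ≤ 3.25 * r)
    (hzx : ‖z - x‖ ≤ 3.25 * r) :
    ‖z - y‖ ≤ (1 + 4 * (κ * r)) * ‖tangentProj T x z - tangentProj T x y‖ := by
  have h1 := hT.norm_perp_secant_le hM hκ hU hr hκr hx hy hz hyx hzx
  have h2 := norm_sq_eq_tangentProj (T := T) x z y
  have hk : 0 < κ * r := by positivity
  set k := κ * r
  set n := ‖z - y‖
  set t := ‖tangentProj T x z - tangentProj T x y‖
  have hn : 0 ≤ n := norm_nonneg _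
  have h3 := pow_le_pow_left₀ (norm_nonneg _) h1 2
  have h4 : (1 - (17 * k) ^ 2) * n ^ 2 ≤ t ^ 2 := by nlinarith
  have h5 : 1 ≤ (1 + 4 * k) ^ 2 * (1 - (17 * k) ^ 2) := by
    have e : (1 + 4 * k) ^ 2 * (1 - (17 * k) ^ 2) - 1 =
        k * (8 - k * (273 + 2312 * k + 4624 * k ^ 2)) := by ring
    have h6 : k * (273 + 2312 * k + 4624 * k ^ 2) ≤
        1 / 48 * (273 + 2312 * (1 / 48) + 4624 * (1 / 48) ^ 2) := by gcongr
    have : 0 ≤ k * (8 - k * (273 + 2312 * k + 4624 * k ^ 2)) :=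
      mul_nonneg hk.le (by norm_num at h6 ⊢; linarith)
    linarith
  refine le_of_sq_le_sq ?_ (by positivity)
  rw [mul_pow]
  nlinarith [sq_nonneg n, mul_le_mul_of_nonneg_left h4 (sq_nonneg (1 + 4 * k))]

/-- If the tangential projection of a point of `M` lies in a slightly smaller ball around the
projection of `q`, then the point lies in the ball around `q`. -/
theorem TangentField.norm_sub_le_of_tangentProj (hT : TangentField d M T) (hM : IsCompact M)
    (hκ : 0 < κ) (hU : UniqueFoot M (1 / κ)) (hr : 0 < r) (hκr : κ * r ≤ 1 / 48)
    {x p q : E} (hx : x ∈ M) (hp : p ∈ M) (hq : q ∈ M) (hpx : ‖p - x‖ ≤ 3.25 * r)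
    (hqx : ‖q - x‖ ≤ 2 * r) {ρ : ℝ} (hρ : 0.9 * r ≤ ρ)
    (h : ‖tangentProj T x p - tangentProj T x q‖ ≤ ρ - κ * r ^ 2) : ‖p - q‖ ≤ ρ := by
  have hk : 0 < κ * r := by positivity
  have hS : ‖(T x)ᗮ.starProjection (p - q)‖ ≤ 7.29 * (κ * r ^ 2) := by
    have e : p - q = (p - x) - (q - x) := by abel
    have b1 : ‖(T x)ᗮ.starProjection (p - x)‖ ≤ κ / 2 * (3.25 * r) ^ 2 :=
      (hT.norm_perp_le hM hκ hU hx hp).trans (by gcongr)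
    have b2 : ‖(T x)ᗮ.starProjection (q - x)‖ ≤ κ / 2 * (2 * r) ^ 2 :=
      (hT.norm_perp_le hM hκ hU hx hq).trans (by gcongr)
    rw [e, map_sub]
    refine (norm_sub_le _ _).trans ((add_le_add b1 b2).trans ?_)
    have : 0 ≤ κ * r ^ 2 := by positivity
    nlinarith
  have h1 := norm_sq_eq_tangentProj (T := T) x p q
  have h2 := pow_le_pow_left₀ (norm_nonneg _) h 2
  have h3 := pow_le_pow_left₀ (norm_nonneg _) hS 2
  refine le_of_sq_le_sq ?_ (by linarith)
  have h4 : (7.29 * (κ * r ^ 2)) ^ 2 + (κ * r ^ 2) ^ 2 ≤ 2 * ρ * (κ * r ^ 2) := by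
    have h5 : κ * r ^ 2 = (κ * r) * r := by ring
    rw [h5]
    have h6 : (κ * r) * r ≤ 1 / 48 * r := by gcongr
    have h7 : 0 < κ * r * r := by positivity
    have h8 : 55 * (κ * r * r) ≤ 2 * ρ := by linarith
    nlinarith
  nlinarith

theorem TangentField.norm_tangentProj_ge (hT : TangentField d M T) (hM : IsCompact M)
    (hκ : 0 < κ) (hU : UniqueFoot M (1 / κ)) (hr : 0 < r) (hκr : κ * r ≤ 1 / 48)
    {x q : E} (hx : x ∈ M) (hq : q ∈ M) (hqx : ‖q - x‖ ≤ 2 * r) :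
    ‖q - x‖ - κ * r ^ 2 / 24 ≤ ‖tangentProj T x q‖ := by
  have h1 := norm_sq_eq_tangentProj (T := T) x q x
  rw [tangentProj_self, sub_zero] at h1
  have h2 := pow_le_pow_left₀ (norm_nonneg _) (hT.norm_perp_le hM hκ hU hx hq) 2
  set ℓ := ‖q - x‖
  have hℓ : 0 ≤ ℓ := norm_nonneg _
  set w := κ * ℓ / 2 with hw
  have hw0 : 0 ≤ w := by positivity
  have hwk : w ≤ κ * r := by rw [hw]; nlinarith
  have h3 : ℓ * (1 - w ^ 2) ≤ ‖tangentProj T x q‖ := by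
    refine le_of_sq_le_sq ?_ (norm_nonneg _)
    have e : (κ / 2 * ℓ ^ 2) ^ 2 = w ^ 2 * ℓ ^ 2 := by rw [hw]; ring
    rw [e] at h2
    have h4 : (ℓ * (1 - w ^ 2)) ^ 2 = ℓ ^ 2 - w ^ 2 * ℓ ^ 2 - w ^ 2 * (1 - w ^ 2) * ℓ ^ 2 := by ring
    have h5 : 0 ≤ w ^ 2 * (1 - w ^ 2) * ℓ ^ 2 := by
      have : 0 ≤ 1 - w ^ 2 := by nlinarith
      positivity
    linarith
  have h6 : ℓ * w ^ 2 ≤ κ * r ^ 2 / 24 := by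
    have hw2 : w ^ 2 ≤ (κ * r) * (1 / 48) := by nlinarith
    calc ℓ * w ^ 2 ≤ (2 * r) * ((κ * r) * (1 / 48)) := by gcongr
      _ = _ := by ring
  linarith

variable [MeasurableSpace E] [BorelSpace E]

theorem hausdorffMeasure_tangentProj_image_le (x : E) (A : Set E) :
    Measure.hausdorffMeasure (d : ℝ) (tangentProj T x '' A) ≤ Measure.hausdorffMeasure (d : ℝ) A := by
  have : LipschitzOnWith 1 (tangentProj T x) A := LipschitzOnWith.of_dist_le_mul fun p _ q _ => by
    rw [dist_eq_norm, dist_eq_norm, NNReal.coe_one, one_mul]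
    exact norm_tangentProj_sub_le x p q
  simpa using this.hausdorffMeasure_image_le (d := (d : ℝ)) (by positivity)

theorem TangentField.hausdorffMeasure_le_image (hT : TangentField d M T) (hM : IsCompact M)
    (hκ : 0 < κ) (hU : UniqueFoot M (1 / κ)) (hr : 0 < r) (hκr : κ * r ≤ 1 / 48)
    {x : E} (hx : x ∈ M) {A : Set E} (hAM : A ⊆ M) (hA : ∀ p ∈ A, ‖p - x‖ ≤ 3.25 * r) :
    Measure.hausdorffMeasure (d : ℝ) A ≤ ENNReal.ofReal ((1 + 4 * (κ * r)) ^ d) *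
      Measure.hausdorffMeasure (d : ℝ) (tangentProj T x '' A) := by
  have hlip : ∀ p ∈ A, ∀ q ∈ A,
      ‖p - q‖ ≤ (1 + 4 * (κ * r)) * ‖tangentProj T x p - tangentProj T x q‖ := fun p hp q hq =>
    hT.norm_sub_le_tangentProj hM hκ hU hr hκr hx (hAM hq) (hAM hp) (hA q hq) (hA p hp)
  have hinj : InjOn (tangentProj T x) A := by
    intro p hp q hq h
    have h1 := hlip p hp q hq
    rw [h, sub_self, norm_zero, mul_zero] at h1
    exact sub_eq_zero.1 (norm_le_zero_iff.1 h1)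
  have hpos : 0 ≤ 1 + 4 * (κ * r) := by positivity
  have hL : LipschitzOnWith (1 + 4 * (κ * r)).toNNReal (Function.invFunOn (tangentProj T x) A)
      (tangentProj T x '' A) := by
    refine LipschitzOnWith.of_dist_le_mul ?_
    rintro _ ⟨p, hp, rfl⟩ _ ⟨q, hq, rfl⟩
    rw [hinj.leftInvOn_invFunOn hp, hinj.leftInvOn_invFunOn hq, Real.coe_toNNReal _ hpos,
      dist_eq_norm, dist_eq_norm]
    exact hlip p hp q hq
  have h := hL.hausdorffMeasure_image_le (d := (d : ℝ)) (by positivity)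
  have himg : Function.invFunOn (tangentProj T x) A '' (tangentProj T x '' A) = A := by
    rw [image_image]
    exact (image_congr fun p hp => hinj.leftInvOn_invFunOn hp).trans (image_id' A)
  rw [himg, ENNReal.rpow_natCast] at h
  rw [ENNReal.ofReal_pow hpos]
  exact h

/-- The volumes of the intersection and of the union of two balls of radius `ρ` in the manifold are
bounded above by their analogues in Euclidean space. -/
structure LensUpper (μ : Measure E) (M : Set E) (x q : E) (d : ℕ) (Λ c t ρ : ℝ) : Prop where
  inter : μ.real (M ∩ (closedBall x ρ ∩ closedBall q ρ)) ≤
    Λ * (c * ρ ^ d * lensProfile d (t / (2 * ρ)))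
  union : μ.real (M ∩ (closedBall x ρ ∪ closedBall q ρ)) ≤
    Λ * (c * ρ ^ d * (2 * lensProfile d 0 - lensProfile d (t / (2 * ρ))))

/-- The volumes of the intersection and of the union of two balls of radius `ρ` in the manifold are
bounded below by the Euclidean volumes for the smaller radius `ρ'`. -/
structure LensLower (μ : Measure E) (M : Set E) (x q : E) (d : ℕ) (c t ρ ρ' : ℝ) : Prop where
  inter : c * ρ' ^ d * lensProfile d (t / (2 * ρ')) ≤
    μ.real (M ∩ (closedBall x ρ ∩ closedBall q ρ))
  union : c * ρ' ^ d * (2 * lensProfile d 0 - lensProfile d (t / (2 * ρ'))) ≤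
    μ.real (M ∩ (closedBall x ρ ∪ closedBall q ρ))

/-- The tangential projection compares the volumes of intersections and unions of two balls in `M`,
centered at points of `M`, with their Euclidean analogues. The constant `c` normalizes the Hausdorff
measure, and `t` is the distance of the projected centers. -/
theorem TangentField.exists_lens_bounds (hT : TangentField d M T) (hd : 1 ≤ d) (hM : IsCompact M)
    (hfin : Measure.hausdorffMeasure (d : ℝ) M ≠ ∞)
    (hκ : 0 < κ) (hU : UniqueFoot M (1 / κ)) (hr : 0 < r) (hκr : κ * r ≤ 1 / 48)
    {x q : E} (hx : x ∈ M) (hq : q ∈ M) (hqx : ‖q - x‖ ≤ 2 * r) :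
    ∃ c t : ℝ, 0 < c ∧ 0 ≤ t ∧ t ≤ ‖q - x‖ ∧ ‖q - x‖ - κ * r ^ 2 / 24 ≤ t ∧
      (∀ ρ, r ≤ ρ → ρ ≤ 1.1 * r →
        LensUpper (Measure.hausdorffMeasure (d : ℝ)) M x q d ((1 + 4 * (κ * r)) ^ d) c t ρ) ∧
      (∀ ρ, 0.9 * r ≤ ρ → ρ ≤ r → t ≤ 2 * (ρ - κ * r ^ 2) →
        LensLower (Measure.hausdorffMeasure (d : ℝ)) M x q d c t ρ (ρ - κ * r ^ 2)) := by
  obtain ⟨c, hc, hlens⟩ := hausdorffMeasure_lens (V := T x) hd (hT.finrank_eq x hx)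
  set F := tangentProj T x with hF
  set y := F q with hy
  have hyq : ‖y‖ ≤ ‖q - x‖ := by
    have := norm_tangentProj_sub_le (T := T) x q x
    rwa [tangentProj_self, sub_zero] at this
  have hF0 : F x = 0 := tangentProj_self x
  set μ : Measure E := Measure.hausdorffMeasure (d : ℝ) with hμ
  set ν : Measure (T x) := Measure.hausdorffMeasure (d : ℝ) with hν
  have hlens' : ∀ ρ, 0 < ρ → ‖y‖ ≤ 2 * ρ →
      ν (closedBall 0 ρ ∩ closedBall y ρ) ≠ ∞ ∧
      ν.real (closedBall 0 ρ ∩ closedBall y ρ) = c * ρ ^ d * lensProfile d (‖y‖ / (2 * ρ)) ∧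
      ν (closedBall 0 ρ ∪ closedBall y ρ) ≠ ∞ ∧
      ν.real (closedBall 0 ρ ∪ closedBall y ρ) =
        c * ρ ^ d * (2 * lensProfile d 0 - lensProfile d (‖y‖ / (2 * ρ))) := by
    intro ρ hρ hyρ
    have hnn : ∀ a, 0 ≤ a → a ≤ 1 → 0 ≤ lensProfile d a := fun a h0 h1 => by
      simpa [lensProfile] using lensProfile_anti hd h0 h1 le_rfl
    have h1 := hlens ρ hρ y hyρ
    have h1' : ν.real (closedBall 0 ρ ∩ closedBall y ρ) =
        c * ρ ^ d * lensProfile d (‖y‖ / (2 * ρ)) := by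
      rw [Measure.real, h1, ENNReal.toReal_ofReal]
      have := hnn (‖y‖ / (2 * ρ)) (by positivity) (by rwa [div_le_one (by positivity)])
      positivity
    have hball : ∀ z : T x, ν (closedBall z ρ) ≠ ∞ ∧
        ν.real (closedBall z ρ) = c * ρ ^ d * lensProfile d 0 := by
      intro z
      have h2 := hlens ρ hρ 0 (by rw [norm_zero]; positivity)
      rw [inter_self, norm_zero, zero_div] at h2
      have h3 : ν (closedBall z ρ) = ν (closedBall 0 ρ) := by
        have := IsometryEquiv.hausdorffMeasure_image (IsometryEquiv.addRight z) (d : ℝ)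
          (closedBall (0 : T x) ρ)
        rw [IsometryEquiv.image_closedBall] at this
        simpa using this
      rw [Measure.real, h3, h2]
      refine ⟨ENNReal.ofReal_ne_top, ENNReal.toReal_ofReal ?_⟩
      have := hnn 0 le_rfl zero_le_one
      positivity
    have h4 := measureReal_union_add_inter (μ := ν) (s := closedBall 0 ρ) (t := closedBall y ρ)
      measurableSet_closedBall (hball 0).1 (hball y).1
    rw [(hball 0).2, (hball y).2, h1'] at h4
    refine ⟨?_, h1', (measure_union_lt_top (hball 0).1.lt_top (hball y).1.lt_top).ne, ?_⟩
    · rw [h1]; exact ENNReal.ofReal_ne_top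
    · linarith
  have hmap : ∀ ρ p z, p ∈ closedBall z ρ → F p ∈ closedBall (F z) ρ := by
    intro ρ p z hp
    rw [mem_closedBall, dist_eq_norm] at hp ⊢
    exact (norm_tangentProj_sub_le x p z).trans hp
  have hup : ∀ (A : Set E) (B : Set (T x)), A ⊆ M → (∀ p ∈ A, ‖p - x‖ ≤ 3.25 * r) →
      (∀ p ∈ A, F p ∈ B) → ν B ≠ ∞ → μ.real A ≤ (1 + 4 * (κ * r)) ^ d * ν.real B := by
    intro A B hAM hA hAB hB
    have h1 := (hT.hausdorffMeasure_le_image hM hκ hU hr hκr hx hAM hA).trans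
      (mul_le_mul_right (measure_mono (image_subset_iff.2 hAB)) _)
    have h2 := ENNReal.toReal_mono (ENNReal.mul_ne_top ENNReal.ofReal_ne_top hB) h1
    rw [ENNReal.toReal_mul, ENNReal.toReal_ofReal (by positivity)] at h2
    exact h2
  have hlow : ∀ (A : Set E) (B : Set (T x)), (∀ z ∈ B, ‖z‖ ≤ 3 * r) →
      (∀ p ∈ M, ‖p - x‖ ≤ 3.25 * r → F p ∈ B → p ∈ A) → ν.real B ≤ μ.real (M ∩ A) := by
    intro A B hB hAB
    refine ENNReal.toReal_mono ((measure_mono inter_subset_left).trans_lt hfin.lt_top).ne ?_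
    refine (measure_mono ?_).trans (hausdorffMeasure_tangentProj_image_le (T := T) x (M ∩ A))
    intro z hz
    obtain ⟨p, hp, hpz, hpx⟩ := hT.exists_proj_eq hM hκ hU hr hκr hx z.2 (hB z hz)
    have hFp : F p = z := Subtype.ext hpz
    exact ⟨p, ⟨hp, hAB p hp hpx (hFp ▸ hz)⟩, hFp⟩
  have hqx' : ∀ ρ, ρ ≤ 1.1 * r → ∀ p ∈ closedBall x ρ ∪ closedBall q ρ, ‖p - x‖ ≤ 3.25 * r := by
    rintro ρ hρ p (hp | hp) <;> rw [mem_closedBall, dist_eq_norm] at hp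
    · linarith
    · have := norm_add_le (p - q) (q - x)
      rw [sub_add_sub_cancel] at this
      linarith
  refine ⟨c, ‖y‖, hc, norm_nonneg y, hyq,
    hT.norm_tangentProj_ge hM hκ hU hr hκr hx hq hqx, fun ρ hρ1 hρ2 => ?_, fun ρ hρ1 hρ2 hyρ => ?_⟩
  · obtain ⟨f1, e1, f2, e2⟩ := hlens' ρ (by linarith) (by linarith)
    constructor
    · rw [← e1]
      refine hup _ _ inter_subset_left (fun p hp => hqx' ρ hρ2 p (Or.inl hp.2.1))
        (fun p hp => ⟨?_, hmap ρ p q hp.2.2⟩) f1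
      rw [← hF0]; exact hmap ρ p x hp.2.1
    · rw [← e2]
      refine hup _ _ inter_subset_left (fun p hp => hqx' ρ hρ2 p hp.2) (fun p hp => ?_) f2
      rcases hp.2 with h | h
      · left; rw [← hF0]; exact hmap ρ p x h
      · right; exact hmap ρ p q h
  · have hκr2 : κ * r ^ 2 ≤ 1 / 48 * r := by nlinarith
    have hκr3 : 0 < κ * r ^ 2 := by positivity
    obtain ⟨f1, e1, f2, e2⟩ := hlens' (ρ - κ * r ^ 2) (by linarith) hyρ
    have hback : ∀ p ∈ M, ‖p - x‖ ≤ 3.25 * r → ∀ z ∈ M, ‖z - x‖ ≤ 2 * r →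
        F p ∈ closedBall (F z) (ρ - κ * r ^ 2) → p ∈ closedBall z ρ := by
      intro p hp hpx z hz hzx h
      rw [mem_closedBall, dist_eq_norm] at h ⊢
      exact hT.norm_sub_le_of_tangentProj hM hκ hU hr hκr hx hp hz hpx hzx hρ1 h
    have hxx : ‖x - x‖ ≤ 2 * r := by rw [sub_self, norm_zero]; positivity
    have hb0 : ∀ z ∈ closedBall (0 : T x) (ρ - κ * r ^ 2) ∪ closedBall y (ρ - κ * r ^ 2),
        ‖z‖ ≤ 3 * r := by
      rintro z (hz | hz) <;> rw [mem_closedBall, dist_eq_norm] at hz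
      · rw [sub_zero] at hz; linarith
      · have := norm_add_le (z - y) y
        rw [sub_add_cancel] at this
        linarith
    constructor
    · rw [← e1]
      refine hlow _ _ (fun z hz => hb0 z (Or.inl hz.1)) fun p hp hpx h => ⟨?_, ?_⟩
      · exact hback p hp hpx x hx hxx (by rw [hF0]; exact h.1)
      · exact hback p hp hpx q hq hqx h.2
    · rw [← e2]
      refine hlow _ _ hb0 fun p hp hpx h => ?_
      rcases h with h | h
      · exact Or.inl (hback p hp hpx x hx hxx (by rw [hF0]; exact h))
      · exact Or.inr (hback p hp hpx q hq hqx h)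

end Compare

/-! ### Sensitivity of the volume coefficient -/

section Numeric

variable {d : ℕ}

theorem volumeCoef_eq (d : ℕ) {s : ℝ} (hs0 : 0 ≤ s) (hs : s ≤ 2) :
    volumeCoef d s = (2 * (lensProfile d 0 / lensProfile d (s / 2)) - 1)⁻¹ := by
  have h1 := incompleteBeta_eq_lensProfile d le_rfl zero_le_one
  have h2 := incompleteBeta_eq_lensProfile d (a := s / 2) (by positivity) (by linarith)
  rw [show (1 : ℝ) - 0 ^ 2 = 1 by norm_num] at h1
  rw [show 1 - (s / 2) ^ 2 = 1 - s ^ 2 / 4 by ring] at h2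
  rw [volumeCoef, h1, h2, mul_div_mul_left _ _ two_ne_zero]

/-- Relative sensitivity of the volume of a lens to the distance of its centers. -/
theorem lensProfile_le_mul (hd : 1 ≤ d) {α β B Δ : ℝ} (hα : 0 ≤ α) (hα1 : α ≤ 1) (hβ : 0 ≤ β)
    (hβB : β ≤ B) (hB : B < 1) (hΔ : 0 ≤ Δ) (h : β - α ≤ Δ) :
    lensProfile d α ≤ lensProfile d β *
      (1 + (d + 1) * Δ / (1 - B ^ 2) ^ (((d : ℝ) + 1) / 2)) := by
  have hβ1 : β < 1 := hβB.trans_lt hB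
  have hpos := lensProfile_pos hd hβ hβ1
  have hZ0 : 0 < 1 - B ^ 2 := by nlinarith
  set Z := (1 - B ^ 2) ^ (((d : ℝ) + 1) / 2) with hZ
  have hZpos : 0 < Z := by positivity
  have hZle : Z ≤ lensProfile d β * (d + 1) := by
    rw [← div_le_iff₀ (by positivity)]
    refine le_trans ?_ (le_lensProfile hd hβ hβ1.le)
    refine div_le_div_of_nonneg_right ?_ (by positivity)
    exact Real.rpow_le_rpow hZ0.le (by nlinarith) (by positivity)
  have h1 : lensProfile d α ≤ lensProfile d β + Δ := by
    rcases le_total β α with hle | hle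
    · linarith [lensProfile_anti hd hβ hle hα1]
    · linarith [lensProfile_sub_le hd hα hle hβ1.le]
  refine h1.trans ?_
  rw [mul_add, mul_one]
  gcongr
  rw [mul_div_assoc', le_div_iff₀ hZpos]
  nlinarith

/-- Relative sensitivity of the volume of the union of two balls. It needs no lower bound on the
volume of the lens, since the union contains a ball. -/
theorem two_mul_lensProfile_sub_le_mul (hd : 1 ≤ d) {α β Δ : ℝ} (hα : 0 ≤ α) (hα1 : α ≤ 1)
    (hβ : 0 ≤ β) (hβ1 : β ≤ 1) (hΔ : 0 ≤ Δ) (h : β - α ≤ Δ) :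
    2 * lensProfile d 0 - lensProfile d β ≤
      (2 * lensProfile d 0 - lensProfile d α) * (1 + (d + 1) * Δ) := by
  have h0 := lensProfile_anti hd le_rfl hα hα1
  have hone : 1 ≤ lensProfile d 0 * (d + 1) := by
    rw [← div_le_iff₀ (by positivity)]
    simpa using le_lensProfile hd (a := 0) le_rfl zero_le_one
  have h1 : lensProfile d α ≤ lensProfile d β + Δ := by
    rcases le_total β α with hle | hle
    · linarith [lensProfile_anti hd hβ hle hα1]
    · linarith [lensProfile_sub_le hd hα hle hβ1]
  have h2 : 1 ≤ (2 * lensProfile d 0 - lensProfile d α) * (d + 1) := by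
    refine hone.trans ?_
    gcongr
    linarith
  nlinarith

theorem exp_le_one_add_mul {x c : ℝ} (hx : 0 ≤ x) (hx1 : x ≤ 1) (hc : 1 + x ≤ c) :
    Real.exp x ≤ 1 + c * x := by
  have h := Real.abs_exp_sub_one_sub_id_le (x := x) (by rwa [abs_of_nonneg hx])
  have h2 := (abs_le.1 h).2
  nlinarith

/-- The volume distortion of the tangential projection and the change of the radii, to the power of
the dimension. -/
theorem pow_ratio_le {k e : ℝ} (hk : 0 ≤ k) (he : 0 ≤ e) (hk1 : k ≤ 1 / 48) (he1 : e ≤ 1 / 20)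
    (hdk : d * k ≤ 1 / 6) (hde : d * e ≤ 1 / 5) :
    (1 + 4 * k) ^ d * ((1 + 2 * e) / (1 - 2 * e - k)) ^ d ≤
      (1 + 8 * (d * e)) * (1 + 10 * (d * k)) := by
  have hpos : 0 < 1 - 2 * e - k := by linarith
  have h1 : 1 + 4 * k ≤ Real.exp (4 * k) := by linarith [Real.add_one_le_exp (4 * k)]
  have h2 : 1 + 2 * e ≤ Real.exp (2 * e) := by linarith [Real.add_one_le_exp (2 * e)]
  have h3 : 1 / (1 - 2 * e - k) ≤ Real.exp (1.15 * (2 * e + k)) := by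
    refine le_trans ?_ (Real.add_one_le_exp _)
    rw [div_le_iff₀ hpos]
    nlinarith
  have h4 : (1 + 4 * k) * ((1 + 2 * e) / (1 - 2 * e - k)) ≤
      Real.exp (4.3 * e) * Real.exp (5.15 * k) := by
    have : (1 + 4 * k) * ((1 + 2 * e) / (1 - 2 * e - k)) =
        (1 + 4 * k) * (1 + 2 * e) * (1 / (1 - 2 * e - k)) := by ring
    rw [this]
    calc _ ≤ Real.exp (4 * k) * Real.exp (2 * e) * Real.exp (1.15 * (2 * e + k)) := by
          gcongr
      _ = _ := by
          rw [← Real.exp_add, ← Real.exp_add, ← Real.exp_add]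
          congr 1; ring
  rw [← mul_pow]
  calc _ ≤ (Real.exp (4.3 * e) * Real.exp (5.15 * k)) ^ d := by gcongr
    _ = Real.exp (4.3 * (d * e)) * Real.exp (5.15 * (d * k)) := by
        rw [mul_pow, ← Real.exp_nat_mul, ← Real.exp_nat_mul]
        congr 2 <;> ring
    -- both exponents are at most `0.86`, as `4.3 / 5 = 0.86` and `5.15 / 6 < 0.86`
    _ ≤ (1 + 1.86 * (4.3 * (d * e))) * (1 + 1.86 * (5.15 * (d * k))) := by
        have h5 : 0 ≤ d * e := by positivity
        have h6 : 0 ≤ d * k := by positivity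
        gcongr
        · exact exp_le_one_add_mul (by positivity) (by linarith) (by linarith)
        · exact exp_le_one_add_mul (by positivity) (by linarith) (by linarith)
    _ ≤ _ := by
        have h5 : 0 ≤ d * e := by positivity
        have h6 : 0 ≤ d * k := by positivity
        exact mul_le_mul (by linarith) (by linarith) (by positivity) (by positivity)

/-- The product of all error factors is dominated by the product of the two error terms. -/
theorem error_factor_le (hd : 1 ≤ d) {k e Z : ℝ} (hk : 0 ≤ k) (he : 0 ≤ e)
    (hdk : d * k ≤ 1 / 6) (hde : d * e ≤ 1 / 5) (hZ : 0 < Z) (hZ1 : Z ≤ 1) :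
    (1 + 8 * (d * e)) * (1 + 10 * (d * k)) * (1 + (d + 1) * (3.5 * e + 1.2 * k)) *
        (1 + (d + 1) * (3.5 * e + 1.2 * k) / Z) ≤
      (1 + 84 * (d + 1) * k / Z) * (1 + 80 * (d + 1) * e / Z) := by
  have hd' : (1 : ℝ) ≤ d := by exact_mod_cast hd
  set e' := ((d : ℝ) + 1) * e with he'
  set k' := ((d : ℝ) + 1) * k with hk'
  have he0 : 0 ≤ e' := by positivity
  have hk0 : 0 ≤ k' := by positivity
  have hde' : d * e ≤ e' := by rw [he']; nlinarith
  have hdk' : d * k ≤ k' := by rw [hk']; nlinarith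
  have he1 : e' ≤ 2 / 5 := by rw [he']; nlinarith
  have hk1 : k' ≤ 1 / 3 := by rw [hk']; nlinarith
  have hZe : e' ≤ e' / Z := by rw [le_div_iff₀ hZ]; nlinarith
  have hZk : k' ≤ k' / Z := by rw [le_div_iff₀ hZ]; nlinarith
  set x := e' / Z with hx
  set y := k' / Z with hy
  have hx0 : 0 ≤ x := by positivity
  have hy0 : 0 ≤ y := by positivity
  have e1 : ((d : ℝ) + 1) * (3.5 * e + 1.2 * k) = 3.5 * e' + 1.2 * k' := by rw [he', hk']; ring
  have e2 : (3.5 * e' + 1.2 * k') / Z = 3.5 * x + 1.2 * y := by rw [hx, hy]; ring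
  have e3 : 84 * ((d : ℝ) + 1) * k / Z = 84 * y := by rw [hy, hk']; ring
  have e4 : 80 * ((d : ℝ) + 1) * e / Z = 80 * x := by rw [hx, he']; ring
  rw [e1, e2, e3, e4]
  have hE : (1 + 8 * (d * e)) * (1 + 3.5 * e') * (1 + 3.5 * x) ≤ 1 + 80 * x := by
    have h1 : (1 + 8 * (d * e)) * (1 + 3.5 * e') ≤ 1 + 17.1 * e' := by
      nlinarith
    calc _ ≤ (1 + 17.1 * e') * (1 + 3.5 * x) := by gcongr
      _ ≤ _ := by nlinarith
  have hK : (1 + 10 * (d * k)) * (1 + 1.2 * k') * (1 + 1.2 * y) ≤ 1 + 84 * y := by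
    have h1 : (1 + 10 * (d * k)) * (1 + 1.2 * k') ≤ 1 + 13.3 * k' := by
      nlinarith
    calc _ ≤ (1 + 13.3 * k') * (1 + 1.2 * y) := by gcongr
      _ ≤ _ := by nlinarith
  have hde0 : 0 ≤ d * e := by positivity
  have hdk0 : 0 ≤ d * k := by positivity
  calc _ ≤ (1 + 8 * (d * e)) * (1 + 10 * (d * k)) * ((1 + 3.5 * e') * (1 + 1.2 * k')) *
        ((1 + 3.5 * x) * (1 + 1.2 * y)) := by
        gcongr
        · nlinarith [mul_nonneg he0 hk0]
        · nlinarith [mul_nonneg hx0 hy0]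
    _ = ((1 + 10 * (d * k)) * (1 + 1.2 * k') * (1 + 1.2 * y)) *
        ((1 + 8 * (d * e)) * (1 + 3.5 * e') * (1 + 3.5 * x)) := by ring
    _ ≤ _ := by gcongr

end Numeric

/-! ### The gap coefficient -/

section Gap

theorem exists_mem_dist_le_of_mem_support {Ω : Type*} [MeasurableSpace Ω] {E : Type*}
    [NormedAddCommGroup E] [MeasurableSpace E] [BorelSpace E] [SecondCountableTopology E]
    {μ : Measure Ω} {X ξ : Ω → E} (hX : AEMeasurable X μ) (hξ : AEMeasurable ξ μ) {M : Set E}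
    (hM : IsCompact M) (hne : M.Nonempty) {η : ℝ} (hXM : ∀ᵐ ω ∂μ, X ω ∈ M)
    (hη : ∀ᵐ ω ∂μ, ‖ξ ω‖ ≤ η) {y : E} (hy : y ∈ (μ.map (fun ω => X ω + ξ ω)).support) :
    ∃ x ∈ M, ‖y - x‖ ≤ η := by
  obtain ⟨x, hx, hxy⟩ := hM.exists_infDist_eq_dist hne y
  refine ⟨x, hx, ?_⟩
  rw [← dist_eq_norm, ← hxy]
  refine le_of_forall_pos_le_add fun ε hε => ?_
  have h1 := (Measure.mem_support_iff_forall y).1 hy (ball y ε) (ball_mem_nhds y hε)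
  have hXξ : AEMeasurable (fun ω => X ω + ξ ω) μ := hX.add hξ
  rw [Measure.map_apply_of_aemeasurable hXξ measurableSet_ball] at h1
  have h2 : ∃ᶠ ω in ae μ, X ω + ξ ω ∈ ball y ε := by
    intro h
    exact h1.ne' (measure_eq_zero_iff_ae_notMem.2 h)
  obtain ⟨ω, h3, h4, h5⟩ := (h2.and_eventually (hXM.and hη)).exists
  refine (infDist_le_dist_of_mem h4).trans ?_
  rw [mem_ball, dist_comm, dist_eq_norm] at h3
  rw [dist_eq_norm]
  have := norm_add_le (y - (X ω + ξ ω)) (ξ ω)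
  rw [show y - (X ω + ξ ω) + ξ ω = y - X ω by abel] at this
  linarith

variable {Ω : Type*} [MeasurableSpace Ω] {D : ℕ} {μ : Measure Ω}
  {X ξ : Ω → EuclideanSpace ℝ (Fin D)} {P : Measure (EuclideanSpace ℝ (Fin D))}
  {M : Set (EuclideanSpace ℝ (Fin D))} {d : ℕ} {κ rξ r b b' : ℝ}

theorem AssumptionsA.measureReal_map (hA : AssumptionsA μ X ξ P M d κ rξ r b b' r r)
    {A : Set (EuclideanSpace ℝ (Fin D))} (hAm : MeasurableSet A) :
    μ.real (X ⁻¹' A) = (Measure.hausdorffMeasure (d : ℝ)).real (M ∩ A) /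
      (Measure.hausdorffMeasure (d : ℝ)).real M := by
  have h : μ.map X = ProbabilityTheory.cond (Measure.hausdorffMeasure (d : ℝ)) M := hA.uniform
  rw [Measure.real, ← Measure.map_apply_of_aemeasurable hA.aemeasurable_X hAm, h,
    ProbabilityTheory.cond_apply hA.compact.measurableSet, ENNReal.toReal_mul, ENNReal.toReal_inv,
    div_eq_inv_mul]
  rfl

variable [IsProbabilityMeasure μ]

/-- The manifold has positive finite volume: otherwise the normalized restriction would be zero and
not a probability measure. -/
theorem AssumptionsA.hausdorffMeasure_ne (hA : AssumptionsA μ X ξ P M d κ rξ r b b' r r) :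
    Measure.hausdorffMeasure (d : ℝ) M ≠ 0 ∧ Measure.hausdorffMeasure (d : ℝ) M ≠ ∞ := by
  have hp : IsProbabilityMeasure (μ.map X) := Measure.isProbabilityMeasure_map hA.aemeasurable_X
  have h : μ.map X = ProbabilityTheory.cond (Measure.hausdorffMeasure (d : ℝ)) M := hA.uniform
  constructor <;> intro h0
  · rw [ProbabilityTheory.cond_eq_zero_of_meas_eq_zero h0] at h
    exact IsProbabilityMeasure.ne_zero (μ.map X) h
  · rw [ProbabilityTheory.cond, h0, ENNReal.inv_top, zero_smul] at h
    exact IsProbabilityMeasure.ne_zero (μ.map X) h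

theorem AssumptionsA.ae_mem (hA : AssumptionsA μ X ξ P M d κ rξ r b b' r r) :
    ∀ᵐ ω ∂μ, X ω ∈ M := by
  have h := hA.measureReal_map hA.compact.measurableSet.compl
  rw [inter_compl_self, measureReal_empty, zero_div, measureReal_eq_zero_iff] at h
  rw [ae_iff]
  exact h

/-- The law of the noisy sample is bounded below on `S` by the uniform law on a set whose
`rξ`-neighbourhood lies in `S`. -/
theorem AssumptionsA.le_measureReal (hA : AssumptionsA μ X ξ P M d κ rξ r b b' r r)
    {A S : Set (EuclideanSpace ℝ (Fin D))} (hAm : MeasurableSet A) (hS : MeasurableSet S)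
    (h : ∀ p v, p ∈ A → ‖v‖ ≤ rξ → p + v ∈ S) :
    (Measure.hausdorffMeasure (d : ℝ)).real (M ∩ A) / (Measure.hausdorffMeasure (d : ℝ)).real M ≤
      P.real S := by
  have hXξ : AEMeasurable (fun ω => X ω + ξ ω) μ := hA.aemeasurable_X.add hA.aemeasurable_noise
  rw [← hA.measureReal_map hAm, hA.law, map_measureReal_apply_of_aemeasurable hXξ hS]
  refine ENNReal.toReal_mono (measure_ne_top _ _) (measure_mono_ae ?_)
  filter_upwards [hA.noise_le] with ω hω hX
  exact h _ _ hX hω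

theorem AssumptionsA.measureReal_le (hA : AssumptionsA μ X ξ P M d κ rξ r b b' r r)
    {A S : Set (EuclideanSpace ℝ (Fin D))} (hAm : MeasurableSet A) (hS : MeasurableSet S)
    (h : ∀ p v, p + v ∈ S → ‖v‖ ≤ rξ → p ∈ A) :
    P.real S ≤
      (Measure.hausdorffMeasure (d : ℝ)).real (M ∩ A) / (Measure.hausdorffMeasure (d : ℝ)).real M := by
  have hXξ : AEMeasurable (fun ω => X ω + ξ ω) μ := hA.aemeasurable_X.add hA.aemeasurable_noise
  rw [← hA.measureReal_map hAm, hA.law, map_measureReal_apply_of_aemeasurable hXξ hS]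
  refine ENNReal.toReal_mono (measure_ne_top _ _) (measure_mono_ae ?_)
  filter_upwards [hA.noise_le] with ω hω hX
  exact h _ _ hX hω

theorem AssumptionsA.nonempty (hA : AssumptionsA μ X ξ P M d κ rξ r b b' r r) : M.Nonempty := by
  rw [nonempty_iff_ne_empty]
  rintro rfl
  exact hA.hausdorffMeasure_ne.1 measure_empty

theorem AssumptionsA.noise_nonneg (hA : AssumptionsA μ X ξ P M d κ rξ r b b' r r) : 0 ≤ rξ := by
  obtain ⟨ω, h⟩ := hA.noise_le.exists
  exact (norm_nonneg _).trans h

theorem AssumptionsA.exists_near (hA : AssumptionsA μ X ξ P M d κ rξ r b b' r r)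
    {y : EuclideanSpace ℝ (Fin D)} (hy : y ∈ P.support) : ∃ x ∈ M, ‖y - x‖ ≤ rξ := by
  have h := hA.law
  subst h
  exact exists_mem_dist_le_of_mem_support hA.aemeasurable_X hA.aemeasurable_noise hA.compact
    hA.nonempty hA.ae_mem hA.noise_le hy

/-- The consequences of the assumptions for the dimensionless quantities `κ r` and `rξ / r`. -/
theorem AssumptionsA.numeric (hA : AssumptionsA μ X ξ P M d κ rξ r b b' r r) (hr : 0 < r) :
    0 ≤ rξ / r ∧ rξ / r ≤ 1 / 20 ∧ d * (rξ / r) ≤ 1 / 5 ∧ 0 < κ * r ∧ κ * r ≤ 1 / 48 ∧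
      d * (κ * r) ≤ 1 / 6 ∧ b * ((1 + 3 * (κ * r)) * (1 + 5 * (rξ / r))) ≤ b' := by
  have hκ := hA.κ_pos
  have hη := hA.noise_nonneg
  have he : 0 ≤ rξ / r := by positivity
  have hk : 0 < κ * r := by positivity
  have h1 := hA.rξ_le
  have h2 := hA.r₁_le
  have h3 := hA.b_le
  rw [le_div_iff₀ (by positivity)] at h1 h2
  rw [le_div_iff₀ (by positivity)] at h3
  have m1 : rξ / r * max 20 (5 * (d : ℝ)) ≤ 1 := by
    rw [div_mul_eq_mul_div, div_le_one hr]; exact h1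
  have m2 : κ * r * max 48 (6 * (d : ℝ)) ≤ 1 := by linarith
  refine ⟨he, ?_, ?_, hk, ?_, ?_, by rwa [← mul_assoc 3]⟩
  · nlinarith [mul_le_mul_of_nonneg_left (le_max_left (20 : ℝ) (5 * d)) he]
  · nlinarith [mul_le_mul_of_nonneg_left (le_max_right (20 : ℝ) (5 * d)) he]
  · nlinarith [mul_le_mul_of_nonneg_left (le_max_left (48 : ℝ) (6 * d)) hk.le]
  · nlinarith [mul_le_mul_of_nonneg_left (le_max_right (48 : ℝ) (6 * d)) hk.le]

end Gap

/-! ### Bounds for the gap coefficient -/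

section Dimension

/-- Two-sided bound on `(I / U) / (u / w)`, from bounds on `I` and `U` in terms of perturbations
`u₁, u₂` of `u` and `w₁, w₂` of `w`. -/
theorem ratio_bounds {I U A G R S u w u₁ u₂ w₁ w₂ K : ℝ} (hA : 0 < A) (hG : 0 < G) (hR : 0 < R)
    (hS : 0 < S) (hu : 0 < u) (hw : 0 < w) (hu₂ : 0 < u₂) (hw₂ : 0 < w₂)
    (hI : I ≤ A * G * u₁) (hU : A * w₂ ≤ U) (hI' : A * u₂ ≤ I) (hU' : U ≤ A * G * w₁)
    (h1 : u₁ ≤ u * R) (h2 : w ≤ w₂ * S) (h3 : u ≤ u₂ * R) (h4 : w₁ ≤ w * S)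
    (hK : G * S * R ≤ K) : K⁻¹ ≤ I / U / (u / w) ∧ I / U / (u / w) ≤ K := by
  have hIpos : 0 < I := (mul_pos hA hu₂).trans_le hI'
  have hUpos : 0 < U := (mul_pos hA hw₂).trans_le hU
  have hKpos : 0 < K := (by positivity : 0 < G * S * R).trans_le hK
  have e : I / U / (u / w) = I * w / (U * u) := by field_simp
  have hup : I * w ≤ K * (U * u) := by
    calc I * w ≤ A * G * (u * R) * (w₂ * S) := by
          refine mul_le_mul (hI.trans (by gcongr)) h2 hw.le (by positivity)
      _ = G * S * R * (A * w₂ * u) := by ring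
      _ ≤ K * (U * u) := by gcongr
  have hlo : U * u ≤ K * (I * w) := by
    calc U * u ≤ A * G * (w * S) * (u₂ * R) := by
          refine mul_le_mul (hU'.trans (by gcongr)) h3 hu.le (by positivity)
      _ = G * S * R * (A * u₂ * w) := by ring
      _ ≤ K * (I * w) := by gcongr
  rw [e]
  constructor
  · rw [le_div_iff₀ (by positivity), inv_mul_le_iff₀ hKpos]
    exact hlo
  · rw [div_le_iff₀ (by positivity)]
    exact hup

theorem volumeCoef_eq_div {d : ℕ} {s : ℝ} (hs0 : 0 ≤ s) (hs : s ≤ 2)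
    (hpos : 0 < lensProfile d (s / 2)) :
    volumeCoef d s = lensProfile d (s / 2) / (2 * lensProfile d 0 - lensProfile d (s / 2)) := by
  rw [volumeCoef_eq d hs0 hs, ← inv_div]
  field_simp

variable {Ω : Type*} [MeasurableSpace Ω] {D : ℕ} {μ : Measure Ω} [IsProbabilityMeasure μ]
  {X ξ : Ω → EuclideanSpace ℝ (Fin D)} {P : Measure (EuclideanSpace ℝ (Fin D))}
  {M : Set (EuclideanSpace ℝ (Fin D))} {d : ℕ} {κ rξ r b b' : ℝ}

/-- The hypothesis on `b` leaves room for the perturbation of the centers and the radii. -/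
theorem perturbed_dist_le {e k s b b' : ℝ} (he : 0 ≤ e) (he1 : e ≤ 1 / 20) (hk : 0 ≤ k)
    (hk1 : k ≤ 1 / 48) (hsb : s ≤ b) (hb1 : 1 < b)
    (hbb : b * ((1 + 3 * k) * (1 + 5 * e)) ≤ b') : s + 2 * e ≤ b' * (1 - 2 * e - k) := by
  have h1 : 1 + 2 * e ≤ (1 + 3 * k) * (1 + 5 * e) * (1 - 2 * e - k) := by
    have h2 : 1 + 2.5 * e - 1.25 * k ≤ (1 + 5 * e) * (1 - 2 * e - k) := by nlinarith
    have h3 : (1 + 3 * k) * (1 + 2.5 * e - 1.25 * k) ≤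
        (1 + 3 * k) * ((1 + 5 * e) * (1 - 2 * e - k)) := by gcongr
    nlinarith [mul_nonneg hk he]
  calc s + 2 * e ≤ b * (1 + 2 * e) := by nlinarith
    _ ≤ b * ((1 + 3 * k) * (1 + 5 * e) * (1 - 2 * e - k)) := by gcongr
    _ = b * ((1 + 3 * k) * (1 + 5 * e)) * (1 - 2 * e - k) := by ring
    _ ≤ _ := mul_le_mul_of_nonneg_right hbb (by linarith)

/-- The perturbation of the half distance of the centers, relative to the radius. -/
theorem half_dist_perturbation {r e k s t : ℝ} (hr : 0 < r) (he : 0 ≤ e) (he1 : e ≤ 1 / 20)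
    (hk : 0 ≤ k) (hk1 : k ≤ 1 / 48) (hs2 : s ≤ 2)
    (htle : t ≤ r * (s + 2 * e)) (htge : r * (s - 2 * e - k / 24) ≤ t) :
    s / 2 - t / (2 * (r * (1 + 2 * e))) ≤ 3.5 * e + 1.2 * k ∧
      t / (2 * (r * (1 - 2 * e - k))) - s / 2 ≤ 3.5 * e + 1.2 * k := by
  have hpos : 0 < 1 - 2 * e - k := by linarith
  constructor
  · rw [sub_le_comm, le_div_iff₀ (by positivity)]
    refine le_trans ?_ htge
    rw [show (s / 2 - (3.5 * e + 1.2 * k)) * (2 * (r * (1 + 2 * e))) =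
      r * ((s - 2 * (3.5 * e + 1.2 * k)) * (1 + 2 * e)) by ring]
    gcongr
    nlinarith [mul_nonneg he hk, mul_nonneg he he]
  · rw [sub_le_iff_le_add, div_le_iff₀ (by positivity)]
    refine htle.trans ?_
    rw [show (3.5 * e + 1.2 * k + s / 2) * (2 * (r * (1 - 2 * e - k))) =
      r * ((s + 2 * (3.5 * e + 1.2 * k)) * (1 - 2 * e - k)) by ring]
    gcongr
    have h1 : 2 * (3.5 * e + 1.2 * k) * 0.879 ≤ 2 * (3.5 * e + 1.2 * k) * (1 - 2 * e - k) := by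
      gcongr; linarith
    have h2 : s * (2 * e + k) ≤ 2 * (2 * e + k) := by gcongr
    nlinarith

/-- Bounds on the gap coefficient by volumes of Euclidean lenses with perturbed parameters imply the
bounds by the volume coefficient. Here `e` and `k` measure the noise and the curvature. -/
theorem ratio_bounds_of_lens_bounds (hd : 1 ≤ d) {r e k s t c N I U b' : ℝ} (hr : 0 < r)
    (he : 0 ≤ e) (he1 : e ≤ 1 / 20) (hde : d * e ≤ 1 / 5) (hk : 0 < k) (hk1 : k ≤ 1 / 48)
    (hdk : d * k ≤ 1 / 6) (hs0 : 0 ≤ s) (hsb : s ≤ b') (hb2 : b' < 2) (ht0 : 0 ≤ t)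
    (hc : 0 < c) (hN : 0 < N) (htle : t ≤ r * (s + 2 * e))
    (htge : r * (s - 2 * e - k / 24) ≤ t) (hsb' : s + 2 * e ≤ b' * (1 - 2 * e - k))
    (hI₁ : I ≤ (1 + 4 * k) ^ d * (c * (r * (1 + 2 * e)) ^ d *
      lensProfile d (t / (2 * (r * (1 + 2 * e))))) / N)
    (hU₁ : U ≤ (1 + 4 * k) ^ d * (c * (r * (1 + 2 * e)) ^ d *
      (2 * lensProfile d 0 - lensProfile d (t / (2 * (r * (1 + 2 * e)))))) / N)
    (hI₂ : c * (r * (1 - 2 * e - k)) ^ d *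
      lensProfile d (t / (2 * (r * (1 - 2 * e - k)))) / N ≤ I)
    (hU₂ : c * (r * (1 - 2 * e - k)) ^ d *
      (2 * lensProfile d 0 - lensProfile d (t / (2 * (r * (1 - 2 * e - k))))) / N ≤ U) :
    ((1 + 84 * (d + 1) * k / (1 - (b' / 2) ^ 2) ^ (((d : ℝ) + 1) / 2)) *
        (1 + 80 * (d + 1) * e / (1 - (b' / 2) ^ 2) ^ (((d : ℝ) + 1) / 2)))⁻¹ ≤
        I / U / (lensProfile d (s / 2) / (2 * lensProfile d 0 - lensProfile d (s / 2))) ∧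
      I / U / (lensProfile d (s / 2) / (2 * lensProfile d 0 - lensProfile d (s / 2))) ≤
      (1 + 84 * (d + 1) * k / (1 - (b' / 2) ^ 2) ^ (((d : ℝ) + 1) / 2)) *
        (1 + 80 * (d + 1) * e / (1 - (b' / 2) ^ 2) ^ (((d : ℝ) + 1) / 2)) := by
  have hpos : 0 < 1 - 2 * e - k := by linarith
  obtain ⟨hsa₁, hsa₂⟩ := half_dist_perturbation hr he he1 hk.le hk1 (by linarith) htle htge
  have ha₂B : t / (2 * (r * (1 - 2 * e - k))) ≤ b' / 2 := by
    rw [div_le_iff₀ (by positivity)]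
    have : r * (s + 2 * e) ≤ r * (b' * (1 - 2 * e - k)) := by gcongr
    linarith
  have ha₁₂ : t / (2 * (r * (1 + 2 * e))) ≤ t / (2 * (r * (1 - 2 * e - k))) := by
    gcongr; linarith
  have ha₁0 : 0 ≤ t / (2 * (r * (1 + 2 * e))) := by positivity
  have ha₂0 : 0 ≤ t / (2 * (r * (1 - 2 * e - k))) := by positivity
  generalize t / (2 * (r * (1 + 2 * e))) = a₁ at *
  generalize t / (2 * (r * (1 - 2 * e - k))) = a₂ at *
  have hΔ0 : 0 ≤ 3.5 * e + 1.2 * k := by positivity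
  have hB1 : b' / 2 < 1 := by linarith
  have hsB : s / 2 ≤ b' / 2 := by linarith
  have hsm0 : 0 ≤ s / 2 := by positivity
  have hB0 : 0 ≤ b' / 2 := hsm0.trans hsB
  have hZ0 : 0 < 1 - (b' / 2) ^ 2 := by nlinarith
  have hZpos : 0 < (1 - (b' / 2) ^ 2) ^ (((d : ℝ) + 1) / 2) := by positivity
  have hZ1 : (1 - (b' / 2) ^ 2) ^ (((d : ℝ) + 1) / 2) ≤ 1 :=
    Real.rpow_le_one hZ0.le (by nlinarith [sq_nonneg (b' / 2)]) (by positivity)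
  have hposu := fun a (h0 : 0 ≤ a) (h1 : a ≤ b' / 2) => lensProfile_pos hd h0 (h1.trans_lt hB1)
  have hposw : ∀ a, 0 ≤ a → a ≤ b' / 2 → 0 < 2 * lensProfile d 0 - lensProfile d a :=
    fun a h0 h1 => by
      have := lensProfile_anti hd le_rfl h0 (h1.trans hB1.le)
      have := lensProfile_pos hd le_rfl one_pos
      linarith
  have hG : (1 + 4 * k) ^ d * (r * (1 + 2 * e)) ^ d = (r * (1 - 2 * e - k)) ^ d *
      ((1 + 4 * k) ^ d * ((1 + 2 * e) / (1 - 2 * e - k)) ^ d) := by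
    rw [mul_left_comm, ← mul_pow (r * (1 - 2 * e - k))]
    congr 2
    field_simp
  have hEq : ∀ w, (1 + 4 * k) ^ d * (c * (r * (1 + 2 * e)) ^ d * w) / N =
      c * (r * (1 - 2 * e - k)) ^ d / N *
        ((1 + 4 * k) ^ d * ((1 + 2 * e) / (1 - 2 * e - k)) ^ d) * w := by
    intro w
    rw [show (1 + 4 * k) ^ d * (c * (r * (1 + 2 * e)) ^ d * w) =
      c * ((1 + 4 * k) ^ d * (r * (1 + 2 * e)) ^ d) * w by ring, hG]
    ring
  rw [hEq] at hI₁ hU₁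
  rw [← div_mul_eq_mul_div] at hI₂ hU₂
  refine ratio_bounds (A := c * (r * (1 - 2 * e - k)) ^ d / N)
    (G := (1 + 4 * k) ^ d * ((1 + 2 * e) / (1 - 2 * e - k)) ^ d)
    (R := 1 + (d + 1) * (3.5 * e + 1.2 * k) / (1 - (b' / 2) ^ 2) ^ (((d : ℝ) + 1) / 2))
    (S := 1 + (d + 1) * (3.5 * e + 1.2 * k))
    (by positivity) (by positivity) (by positivity) (by positivity) (hposu _ hsm0 hsB)
    (hposw _ hsm0 hsB) (hposu _ ha₂0 ha₂B) (hposw _ ha₂0 ha₂B) hI₁ hU₂ hI₂ hU₁ ?_ ?_ ?_ ?_ ?_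
  · exact lensProfile_le_mul hd ha₁0 (by linarith) hsm0 hsB hB1 hΔ0 hsa₁
  · exact two_mul_lensProfile_sub_le_mul hd ha₂0 (by linarith) hsm0 (by linarith) hΔ0 (by linarith)
  · exact lensProfile_le_mul hd hsm0 (by linarith) ha₂0 ha₂B hB1 hΔ0 hsa₂
  · exact two_mul_lensProfile_sub_le_mul hd hsm0 (by linarith) ha₁0 (by linarith) hΔ0 (by linarith)
  · refine le_trans ?_ (error_factor_le hd hk.le he hdk hde hZpos hZ1)
    exact mul_le_mul_of_nonneg_right (mul_le_mul_of_nonneg_right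
      (pow_ratio_le hk.le he hk1 he1 hdk hde) (by positivity)) (by positivity)

/-- The gap probabilities of the noisy sample are squeezed between normalized volumes in `M`, with
centers moved to points of `M` and radii changed by `2 rξ`. -/
theorem AssumptionsA.sandwich (hA : AssumptionsA μ X ξ P M d κ rξ r b b' r r)
    {M₁ M₂ x₁ x₂ : EuclideanSpace ℝ (Fin D)} (hd₁ : ‖M₁ - x₁‖ ≤ rξ) (hd₂ : ‖M₂ - x₂‖ ≤ rξ)
    {ρ₁ ρ₂ : ℝ} (hρ₁ : ρ₁ = r + 2 * rξ) (hρ₂ : ρ₂ = r - 2 * rξ) :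
    (P.real (closedBall M₁ r ∩ closedBall M₂ r) ≤
        (Measure.hausdorffMeasure (d : ℝ)).real (M ∩ (closedBall x₁ ρ₁ ∩ closedBall x₂ ρ₁)) /
          (Measure.hausdorffMeasure (d : ℝ)).real M) ∧
      (P.real (closedBall M₁ r ∪ closedBall M₂ r) ≤
        (Measure.hausdorffMeasure (d : ℝ)).real (M ∩ (closedBall x₁ ρ₁ ∪ closedBall x₂ ρ₁)) /
          (Measure.hausdorffMeasure (d : ℝ)).real M) ∧
      ((Measure.hausdorffMeasure (d : ℝ)).real (M ∩ (closedBall x₁ ρ₂ ∩ closedBall x₂ ρ₂)) /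
          (Measure.hausdorffMeasure (d : ℝ)).real M ≤
        P.real (closedBall M₁ r ∩ closedBall M₂ r)) ∧
      ((Measure.hausdorffMeasure (d : ℝ)).real (M ∩ (closedBall x₁ ρ₂ ∪ closedBall x₂ ρ₂)) /
          (Measure.hausdorffMeasure (d : ℝ)).real M ≤
        P.real (closedBall M₁ r ∪ closedBall M₂ r)) := by
  have hin : ∀ {x y p v : EuclideanSpace ℝ (Fin D)}, ‖y - x‖ ≤ rξ → ‖v‖ ≤ rξ →
      p ∈ closedBall x ρ₂ → p + v ∈ closedBall y r := by
    intro x y p v h1 h2 h3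
    rw [mem_closedBall, dist_eq_norm] at h3 ⊢
    have h := norm_add₃_le (a := p - x) (b := v) (c := x - y)
    rw [norm_sub_rev x y, show p - x + v + (x - y) = p + v - y by abel] at h
    linarith
  have hout : ∀ {x y p v : EuclideanSpace ℝ (Fin D)}, ‖y - x‖ ≤ rξ → ‖v‖ ≤ rξ →
      p + v ∈ closedBall y r → p ∈ closedBall x ρ₁ := by
    intro x y p v h1 h2 h3
    rw [mem_closedBall, dist_eq_norm] at h3 ⊢
    have h := norm_add₃_le (a := p + v - y) (b := -v) (c := y - x)
    rw [norm_neg, show p + v - y + -v + (y - x) = p - x by abel] at h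
    linarith
  have hmI : ∀ (x y : EuclideanSpace ℝ (Fin D)) ρ,
      MeasurableSet (closedBall x ρ ∩ closedBall y ρ) :=
    fun _ _ _ => measurableSet_closedBall.inter measurableSet_closedBall
  have hmU : ∀ (x y : EuclideanSpace ℝ (Fin D)) ρ,
      MeasurableSet (closedBall x ρ ∪ closedBall y ρ) :=
    fun _ _ _ => measurableSet_closedBall.union measurableSet_closedBall
  refine ⟨?_, ?_, ?_, ?_⟩
  · exact hA.measureReal_le (hmI _ _ _) (hmI _ _ _) fun p v h hv => ⟨hout hd₁ hv h.1, hout hd₂ hv h.2⟩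
  · exact hA.measureReal_le (hmU _ _ _) (hmU _ _ _) fun p v h hv => h.imp (hout hd₁ hv) (hout hd₂ hv)
  · exact hA.le_measureReal (hmI _ _ _) (hmI _ _ _) fun p v h hv => ⟨hin hd₁ hv h.1, hin hd₂ hv h.2⟩
  · exact hA.le_measureReal (hmU _ _ _) (hmU _ _ _) fun p v h hv => h.imp (hin hd₁ hv) (hin hd₂ hv)

theorem gapCoef_div_volumeCoef_of_one_le (hd : 1 ≤ d) (hr : 0 < r)
    (hA : AssumptionsA μ X ξ P M d κ rξ r b b' r r)
    {M₁ M₂ : EuclideanSpace ℝ (Fin D)} (hM₁ : M₁ ∈ P.support) (hM₂ : M₂ ∈ P.support)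
    (hdist : dist M₁ M₂ ≤ b * r) :
    ((1 + epsManifold d κ r b') * (1 + epsNoise d rξ r b'))⁻¹ ≤
        gapCoef P M₁ M₂ r / volumeCoef d (dist M₁ M₂ / r) ∧
      gapCoef P M₁ M₂ r / volumeCoef d (dist M₁ M₂ / r) ≤
        (1 + epsManifold d κ r b') * (1 + epsNoise d rξ r b') := by
  have hκ := hA.κ_pos
  have hM := hA.compact
  obtain ⟨T, hT⟩ := hA.submanifold.exists_tangentField
  have hU : UniqueFoot M (1 / κ) := uniqueFoot_of_le_reach hA.nonempty hA.le_reach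
  obtain ⟨x₁, hx₁, hd₁⟩ := hA.exists_near hM₁
  obtain ⟨x₂, hx₂, hd₂⟩ := hA.exists_near hM₂
  obtain ⟨he, he1, hde, hk, hk1, hdk, hbb⟩ := hA.numeric hr
  obtain ⟨hN0, hNtop⟩ := hA.hausdorffMeasure_ne
  have hb1 := hA.one_lt_b
  have hb2 := hA.b'_lt
  have hεM : epsManifold d κ r b' =
      84 * (d + 1) * (κ * r) / (1 - (b' / 2) ^ 2) ^ (((d : ℝ) + 1) / 2) := by
    rw [epsManifold]; ring
  have hεξ : epsNoise d rξ r b' =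
      80 * (d + 1) * (rξ / r) / (1 - (b' / 2) ^ 2) ^ (((d : ℝ) + 1) / 2) := rfl
  have hη : rξ = r * (rξ / r) := by field_simp
  have hsr : dist M₁ M₂ = dist M₁ M₂ / r * r := by field_simp
  have hs0 : 0 ≤ dist M₁ M₂ / r := by positivity
  have hsb : dist M₁ M₂ / r ≤ b := by rw [div_le_iff₀ hr]; exact hdist
  rw [hεM, hεξ]
  generalize hs_def : dist M₁ M₂ / r = s at *
  generalize he_def : rξ / r = e at *
  have hsb' := perturbed_dist_le he he1 hk.le hk1 hsb hb1 hbb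
  have hbb' : b ≤ b' := by
    refine le_trans ?_ hbb
    nlinarith [mul_nonneg hk.le he]
  have hpos : 0 < 1 - 2 * e - κ * r := by linarith
  have hq1 : ‖x₂ - x₁‖ ≤ r * (s + 2 * e) := by
    have h := norm_add₃_le (a := x₂ - M₂) (b := M₂ - M₁) (c := M₁ - x₁)
    rw [sub_add_sub_cancel, sub_add_sub_cancel, norm_sub_rev x₂ M₂, norm_sub_rev M₂ M₁,
      ← dist_eq_norm M₁ M₂, hsr] at h
    linarith
  have hq2 : r * (s - 2 * e) ≤ ‖x₂ - x₁‖ := by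
    have h := norm_add₃_le (a := M₂ - x₂) (b := x₂ - x₁) (c := x₁ - M₁)
    rw [sub_add_sub_cancel, sub_add_sub_cancel, norm_sub_rev x₁ M₁, norm_sub_rev M₂ M₁,
      ← dist_eq_norm M₁ M₂, hsr] at h
    linarith
  have hbr : b' * (1 - 2 * e - κ * r) ≤ 2 * (1 - 2 * e - κ * r) := by gcongr
  have hqx : ‖x₂ - x₁‖ ≤ 2 * r := by
    refine hq1.trans ?_
    rw [mul_comm 2 r]
    gcongr
    linarith
  obtain ⟨c, t, hc, ht0, ht1, ht2, hup, hlow⟩ :=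
    hT.exists_lens_bounds hd hM hNtop hκ hU hr hk1 hx₁ hx₂ hqx
  have htle : t ≤ r * (s + 2 * e) := ht1.trans hq1
  have htge : r * (s - 2 * e - κ * r / 24) ≤ t := by
    refine le_trans ?_ ht2
    rw [show r * (s - 2 * e - κ * r / 24) = r * (s - 2 * e) - κ * r ^ 2 / 24 by ring]
    linarith
  have hρk : r * (1 - 2 * e) - κ * r ^ 2 = r * (1 - 2 * e - κ * r) := by ring
  obtain ⟨hI₁, hU₁⟩ := hup (r * (1 + 2 * e)) (le_mul_of_one_le_right hr.le (by linarith))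
    (by rw [mul_comm]; gcongr; linarith)
  obtain ⟨hI₂, hU₂⟩ := hlow (r * (1 - 2 * e)) (by rw [mul_comm]; gcongr; linarith)
    (mul_le_of_le_one_right hr.le (by linarith)) (by
      rw [hρk, mul_left_comm]
      refine htle.trans ?_
      gcongr
      linarith)
  rw [hρk] at hI₂ hU₂
  have hNpos : 0 < (Measure.hausdorffMeasure (d : ℝ)).real M := ENNReal.toReal_pos hN0 hNtop
  obtain ⟨pI₁, pU₁, pI₂, pU₂⟩ := hA.sandwich hd₁ hd₂ (ρ₁ := r * (1 + 2 * e))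
    (ρ₂ := r * (1 - 2 * e)) (by rw [hη]; ring) (by rw [hη]; ring)
  have hprof : 0 < lensProfile d (s / 2) := lensProfile_pos hd (by positivity) (by linarith)
  rw [volumeCoef_eq_div hs0 (by linarith) hprof, gapCoef]
  exact ratio_bounds_of_lens_bounds hd hr he he1 hde hk hk1 hdk hs0 (by linarith) hb2 ht0 hc hNpos
    htle htge hsb'
    (pI₁.trans (div_le_div_of_nonneg_right hI₁ hNpos.le))
    (pU₁.trans (div_le_div_of_nonneg_right hU₁ hNpos.le))
    ((div_le_div_of_nonneg_right hI₂ hNpos.le).trans pI₂)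
    ((div_le_div_of_nonneg_right hU₂ hNpos.le).trans pU₂)

/-- In dimension zero the profile is the arc cosine, with a singular but integrable integrand. -/
theorem lensProfile_zero_bounds {a : ℝ} (ha0 : 0 ≤ a) (ha : a ≤ 1 / 2) :
    lensProfile 0 a ≤ lensProfile 0 0 ∧ lensProfile 0 0 ≤ lensProfile 0 a + 2 * a ∧
      1 - a ≤ lensProfile 0 a := by
  set f : ℝ → ℝ := fun u => (1 - u ^ 2) ^ ((((0 : ℕ) : ℝ) - 1) / 2) with hf
  have hexp : (((0 : ℕ) : ℝ) - 1) / 2 = -(1 / 2) := by norm_num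
  have hint : IntervalIntegrable f volume 0 1 := by
    have h1 : IntervalIntegrable (fun u : ℝ => (1 - u) ^ (-(1 / 2) : ℝ)) volume 0 1 := by
      have := (intervalIntegral.intervalIntegrable_rpow' (a := 1) (b := 0) (r := -(1 / 2))
        (by norm_num)).comp_sub_left 1
      simpa using this
    rw [intervalIntegrable_iff_integrableOn_Ioo_of_le zero_le_one] at h1 ⊢
    refine Integrable.mono' h1 
      (Measurable.pow_const (by fun_prop) _).aestronglyMeasurable ?_
    refine (ae_restrict_iff' measurableSet_Ioo).2 (Eventually.of_forall fun u hu => ?_)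
    have h2 : 0 < 1 - u ^ 2 := by nlinarith [hu.1, hu.2]
    simp only [hf, hexp]
    rw [Real.norm_of_nonneg (by positivity)]
    exact Real.rpow_le_rpow_of_nonpos (by linarith [hu.2]) (by nlinarith [hu.1, hu.2]) (by norm_num)
  have hsub : ∀ {x y : ℝ}, 0 ≤ x → x ≤ y → y ≤ 1 → IntervalIntegrable f volume x y :=
    fun h0 h1 h2 => hint.mono_set (by
      rw [uIcc_of_le h1, uIcc_of_le zero_le_one]; exact Icc_subset_Icc h0 h2)
  have hadd : lensProfile 0 0 = (∫ u in (0 : ℝ)..a, f u) + lensProfile 0 a :=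
    (intervalIntegral.integral_add_adjacent_intervals (hsub le_rfl ha0 (by linarith))
      (hsub ha0 (by linarith) le_rfl)).symm
  have hlow : 0 ≤ ∫ u in (0 : ℝ)..a, f u := intervalIntegral.integral_nonneg ha0 fun u hu =>
    Real.rpow_nonneg (by nlinarith [hu.1, hu.2]) _
  have hup : ∫ u in (0 : ℝ)..a, f u ≤ 2 * a := by
    have : ∫ u in (0 : ℝ)..a, f u ≤ ∫ _ in (0 : ℝ)..a, (2 : ℝ) := by
      refine intervalIntegral.integral_mono_on ha0 (hsub le_rfl ha0 (by linarith))
        (continuous_const.intervalIntegrable _ _) fun u hu => ?_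
      have h1 : 1 / 4 ≤ 1 - u ^ 2 := by nlinarith [hu.1, hu.2]
      simp only [hf, hexp]
      calc (1 - u ^ 2) ^ (-(1 / 2) : ℝ) ≤ (1 / 4) ^ (-(1 / 2) : ℝ) :=
            Real.rpow_le_rpow_of_nonpos (by norm_num) h1 (by norm_num)
        _ = 2 := by
            rw [show (1 / 4 : ℝ) = 2 ^ (-2 : ℝ) by norm_num [Real.rpow_neg], ← Real.rpow_mul two_pos.le]
            norm_num
    refine this.trans (le_of_eq ?_)
    rw [intervalIntegral.integral_const, smul_eq_mul]; ring
  refine ⟨by linarith, by linarith, ?_⟩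
  have h1 : ∫ _ in a..1, (1 : ℝ) ≤ ∫ u in a..1, f u := by
    rw [intervalIntegral.integral_of_le (by linarith), intervalIntegral.integral_of_le (by linarith),
      integral_Ioc_eq_integral_Ioo, integral_Ioc_eq_integral_Ioo]
    refine setIntegral_mono_on (by simp) ?_ measurableSet_Ioo fun u hu => ?_
    · exact (intervalIntegrable_iff_integrableOn_Ioo_of_le (by linarith)).1
        (hsub ha0 (by linarith) le_rfl)
    · have h2 : 0 < 1 - u ^ 2 := by nlinarith [hu.1, hu.2]
      simp only [hf, hexp]
      exact Real.one_le_rpow_of_pos_of_le_one_of_nonpos h2 (by nlinarith [hu.1, hu.2]) (by norm_num)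
  simpa [lensProfile, hf] using h1

/-- In dimension zero both balls see the same single point of `M`, so the gap coefficient is `1` and
only the deviation of `volumeCoef 0 s` from `1` has to be estimated. -/
theorem gapCoef_div_volumeCoef_of_dim_zero (hr : 0 < r)
    (hA : AssumptionsA μ X ξ P M 0 κ rξ r b b' r r)
    {M₁ M₂ : EuclideanSpace ℝ (Fin D)} (hM₁ : M₁ ∈ P.support) (hM₂ : M₂ ∈ P.support)
    (hdist : dist M₁ M₂ ≤ b * r) :
    ((1 + epsManifold 0 κ r b') * (1 + epsNoise 0 rξ r b'))⁻¹ ≤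
        gapCoef P M₁ M₂ r / volumeCoef 0 (dist M₁ M₂ / r) ∧
      gapCoef P M₁ M₂ r / volumeCoef 0 (dist M₁ M₂ / r) ≤
        (1 + epsManifold 0 κ r b') * (1 + epsNoise 0 rξ r b') := by
  have hκ := hA.κ_pos
  have hM := hA.compact
  obtain ⟨T, hT⟩ := hA.submanifold.exists_tangentField
  have hU : UniqueFoot M (1 / κ) := uniqueFoot_of_le_reach hA.nonempty hA.le_reach
  obtain ⟨x₁, hx₁, hd₁⟩ := hA.exists_near hM₁
  obtain ⟨x₂, hx₂, hd₂⟩ := hA.exists_near hM₂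
  obtain ⟨he, he1, -, hk, hk1, -, hbb⟩ := hA.numeric hr
  have hb1 := hA.one_lt_b
  have hb2 := hA.b'_lt
  have hηr : rξ ≤ 1 / 20 * r := by rwa [div_le_iff₀ hr] at he1
  -- the points of `M` are isolated, since the tangent spaces are trivial
  have hiso : ∀ x ∈ M, ∀ y ∈ M, ‖y - x‖ ≤ 4 * r → y = x := by
    intro x hx y hy hyx
    have h1 := hT.norm_perp_le hM hκ hU hx hy
    rw [Submodule.starProjection_eq_self_iff.2 (by
      rw [Submodule.finrank_eq_zero.1 (hT.finrank_eq x hx), Submodule.bot_orthogonal_eq_top]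
      exact Submodule.mem_top)] at h1
    rw [← sub_eq_zero, ← norm_le_zero_iff]
    have h2 : κ / 2 * ‖y - x‖ ^ 2 ≤ 1 / 20 * ‖y - x‖ := by
      have h3 : κ * ‖y - x‖ ≤ κ * (4 * r) := by gcongr
      nlinarith [norm_nonneg (y - x)]
    linarith
  have hbb' : b ≤ b' := by
    refine le_trans ?_ hbb
    nlinarith [mul_nonneg hk.le he]
  have hx₂₁ : x₂ = x₁ := by
    refine hiso x₁ hx₁ x₂ hx₂ ?_
    have h := norm_add₃_le (a := x₂ - M₂) (b := M₂ - M₁) (c := M₁ - x₁)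
    rw [sub_add_sub_cancel, sub_add_sub_cancel, norm_sub_rev x₂ M₂, norm_sub_rev M₂ M₁,
      ← dist_eq_norm M₁ M₂] at h
    nlinarith
  subst hx₂₁
  have hXξ : AEMeasurable (fun ω => X ω + ξ ω) μ := hA.aemeasurable_X.add hA.aemeasurable_noise
  have hmI : MeasurableSet (closedBall M₁ r ∩ closedBall M₂ r) :=
    measurableSet_closedBall.inter measurableSet_closedBall
  have hmU : MeasurableSet (closedBall M₁ r ∪ closedBall M₂ r) :=
    measurableSet_closedBall.union measurableSet_closedBall
  have hPfin : IsProbabilityMeasure P := by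
    rw [hA.law]; exact Measure.isProbabilityMeasure_map hXξ
  have hIU : P (closedBall M₁ r ∪ closedBall M₂ r) ≤ P (closedBall M₁ r ∩ closedBall M₂ r) := by
    rw [hA.law, Measure.map_apply_of_aemeasurable hXξ hmI, Measure.map_apply_of_aemeasurable hXξ hmU]
    refine measure_mono_ae ?_
    filter_upwards [hA.noise_le, hA.ae_mem] with ω h1 h2 h3
    have key : ∀ m, ‖m - x₂‖ ≤ rξ → X ω + ξ ω ∈ closedBall m r → X ω = x₂ := by
      intro m hm h
      refine hiso x₂ hx₁ _ h2 ?_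
      rw [mem_closedBall, dist_eq_norm] at h
      have h' := norm_add₃_le (a := X ω + ξ ω - m) (b := -ξ ω) (c := m - x₂)
      rw [norm_neg, show X ω + ξ ω - m + -ξ ω + (m - x₂) = X ω - x₂ by abel] at h'
      linarith
    have hX : X ω = x₂ := h3.elim (key M₁ hd₁) (key M₂ hd₂)
    have hin : ∀ m, ‖m - x₂‖ ≤ rξ → X ω + ξ ω ∈ closedBall m r := by
      intro m hm
      rw [mem_closedBall, dist_eq_norm, hX]
      have h' := norm_sub_le (ξ ω) (m - x₂)
      rw [show ξ ω - (m - x₂) = x₂ + ξ ω - m by abel] at h'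
      linarith
    exact ⟨hin M₁ hd₁, hin M₂ hd₂⟩
  have hpos : 0 < P (closedBall M₁ r ∪ closedBall M₂ r) :=
    ((Measure.mem_support_iff_forall _).1 hM₁ _ (closedBall_mem_nhds M₁ hr)).trans_le
      (measure_mono subset_union_left)
  have hgap : gapCoef P M₁ M₂ r = 1 := by
    have : P.real (closedBall M₁ r ∩ closedBall M₂ r) =
        P.real (closedBall M₁ r ∪ closedBall M₂ r) := by
      rw [Measure.real, Measure.real,
        le_antisymm (measure_mono (inter_subset_left.trans subset_union_left)) hIU]
    rw [gapCoef, this]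
    exact div_self (ENNReal.toReal_pos hpos.ne' (measure_ne_top _ _)).ne'
  set e := rξ / r with he_def
  set a := dist M₁ M₂ / r / 2 with ha_def
  have hae : a ≤ e := by
    have h := norm_sub_le (M₁ - x₂) (M₂ - x₂)
    rw [sub_sub_sub_cancel_right, ← dist_eq_norm] at h
    rw [ha_def, he_def, div_div, div_le_div_iff₀ (by positivity) hr]
    nlinarith
  have ha0 : 0 ≤ a := by positivity
  obtain ⟨p1, p2, p3⟩ := lensProfile_zero_bounds ha0 (by linarith)
  have hupos : 0 < lensProfile 0 a := by linarith
  rw [hgap, volumeCoef_eq_div (by positivity) (by rw [ha_def] at hae; linarith) hupos, one_div_div]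
  set u := lensProfile 0 a
  have hZ0 : 0 < 1 - (b' / 2) ^ 2 := by nlinarith
  set Z := (1 - (b' / 2) ^ 2) ^ ((((0 : ℕ) : ℝ) + 1) / 2) with hZ
  have hZpos : 0 < Z := by positivity
  have hZ1 : Z ≤ 1 := Real.rpow_le_one hZ0.le (by nlinarith [sq_nonneg (b' / 2)]) (by positivity)
  have hεM : 0 ≤ epsManifold 0 κ r b' := by rw [epsManifold, ← hZ]; positivity
  have hεξ : 80 * e ≤ epsNoise 0 rξ r b' := by
    rw [epsNoise, ← hZ, ← he_def, le_div_iff₀ hZpos]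
    push_cast
    nlinarith
  have hεξ0 : 0 ≤ epsNoise 0 rξ r b' := le_trans (by positivity) hεξ
  constructor
  · refine (inv_le_one_of_one_le₀ ?_).trans ?_
    · nlinarith [mul_nonneg hεM hεξ0]
    · rw [one_le_div hupos]; linarith
  · rw [div_le_iff₀ hupos]
    have h1 : 1 + 80 * e ≤ (1 + epsManifold 0 κ r b') * (1 + epsNoise 0 rξ r b') := by
      nlinarith [mul_nonneg hεM hεξ0]
    have h2 : 2 * lensProfile 0 0 - u ≤ (1 + 80 * e) * u := by nlinarith
    exact h2.trans (by gcongr)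

end Dimension

theorem lemma2 {Ω : Type*} [MeasurableSpace Ω] {D : ℕ} (ℙ : Measure Ω) [IsProbabilityMeasure ℙ]
    (X ξ : Ω → EuclideanSpace ℝ (Fin D)) (P : Measure (EuclideanSpace ℝ (Fin D)))
    (M : Set (EuclideanSpace ℝ (Fin D))) (d : ℕ) (κ rξ r b b' : ℝ) (hr : 0 < r)
    (hA : AssumptionsA ℙ X ξ P M d κ rξ r b b' r r)
    (M₁ M₂ : EuclideanSpace ℝ (Fin D)) (hM₁ : M₁ ∈ P.support) (hM₂ : M₂ ∈ P.support)
    (hdist : dist M₁ M₂ ≤ b * r) :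
    (1 + epsManifold d κ r b')⁻¹ * (1 + epsNoise d rξ r b')⁻¹ ≤
        gapCoef P M₁ M₂ r / volumeCoef d (dist M₁ M₂ / r) ∧
      gapCoef P M₁ M₂ r / volumeCoef d (dist M₁ M₂ / r) ≤
        (1 + epsManifold d κ r b') * (1 + epsNoise d rξ r b') := by
  rw [← mul_inv]
  rcases Nat.eq_zero_or_pos d with rfl | hd
  · exact gapCoef_div_volumeCoef_of_dim_zero hr hA hM₁ hM₂ hdist
  · exact gapCoef_div_volumeCoef_of_one_le hd hr hA hM₁ hM₂ hdist
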